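/- Let $d\ge 1$, $\mathbb T^d=\mathbb R^d/2\pi\mathbb Z^d$, $T^*\mathbb T^d=\mathbb T^d\times\mathbb R^d$, and let $|\cdot|$ be the Euclidean norm. For $s>0$ let $\mathcal A_s(\mathbb R^d)$ be the space of real analytic functions $f:\mathbb R^d\to\mathbb R$ whose Fourier transform $\widehat f$ (unitary normalization, $f(\xi)=(2\pi)^{-d/2}\int \widehat f(\eta)e^{i\eta\cdot\xi}d\eta$) is an integrable function with $$\|f\|_{\mathcal A_s}:=\frac1{(2\pi)^{d/2}}\int_{\mathbb R^d}|\widehat f(\eta)|e^{s|\eta|}\,d\eta<\infty ;$$ the norm is defined by the same formula for complex-valued $f$. For $s,\rho>0$ let $\mathcal A_{s,\rho}(T^*\mathbb T^d)$ be the space of real analytic functions $g:T^*\mathbb T^d\to\mathbb R$ with $$\|g\|_{s,\rho}:=\frac1{(2\pi)^{d/2}}\sum_{k\in\mathbb Z^d}\|\widehat g(k,\cdot)\|_{\mathcal A_s}e^{\rho|k|}<\infty,\qquad \widehat g(k,\xi):=\frac1{(2\pi)^{d/2}}\int_{\mathbb T^d}g(x,\xi)e^{-ik\cdot x}\,dx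 .$$ For $\hbar\in(0,1]$ let $\operatorname{Op}_\hbar(a)$ be the semiclassical Weyl quantization on $L^2(\mathbb T^d)$: in the orthonormal basis $e_k(x)=(2\pi)^{-d/2}e^{ik\cdot x}$, $$\langle e_j,\operatorname{Op}_\hbar(a)e_k\rangle=\frac1{(2\pi)^{d/2}}\,\widehat a\Big(j-k,\frac{\hbar(j+k)}2\Big),\qquad j,k\in\mathbb Z^d .$$ Let $\widehat L_{\omega,\hbar}=\omega\cdot\hbar D_x$, $D_x=-i\partial_x$, on its maximal domain in $L^2(\mathbb T^d)$, so that $\widehat L_{\omega,\hbar}e_k=\hbar(\omega\cdot k)e_k$. **Theorem.** Let $\omega\in\mathbb R^d$ satisfy $$|k\cdot\omega|\ge\frac{\varsigma}{|k|^{\gamma-1}}\quad\text{for all }k\in\mathbb Z^d\setminus\{0\},$$ where $\varsigma>0$ and $\gamma>d$. Let $s,\rho>0$, and let $V\in\mathcal A_{s,\rho}(T^*\mathbb T^d)$ satisfy $$\|V\|_{s,\rho}\le\frac{\varsigma}{64}\left(\frac{\sqrt\rho}{2(\gamma-1)}\right)^{2(\gamma-1)} .$$ Then for every $\hbar\in(0,1]$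 there are a unitary operator $\mathcal U_\hbar$ on $L^2(\mathbb T^d)$ and a function $R_\hbar=R_\hbar(\xi)\in\mathcal A_s(\mathbb R^d)$ with $\|R_\hbar\|_{\mathcal A_s}\le 2\|V\|_{s,\rho}$ such that $\operatorname{Op}_\hbar(V-R_\hbar)$ is defined on all of $L^2(\mathbb T^d)$ and $$\mathcal U_\hbar\big(\widehat L_{\omega,\hbar}+\hbar\operatorname{Op}_\hbar(V-R_\hbar)\big)\mathcal U_\hbar^*=\widehat L_{\omega,\hbar},$$ as an equality of unbounded operators, domains included. -/

import Mathlib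

open MeasureTheory Set
open scoped ENNReal InnerProductSpace

namespace QuantumKAM

noncomputable section

/-- The circle `ℝ / 2πℤ` has positive length. -/
instance fact_two_pi_pos : Fact (0 < 2 * Real.pi) := ⟨Real.two_pi_pos⟩

/-- The flat torus `𝕋^d = (ℝ / 2πℤ)^d`; its `volume` is Lebesgue measure, of total mass `(2π)^d`. -/
abbrev Torus (d : ℕ) : Type := Fin d → AddCircle (2 * Real.pi)

/-- `ℝ^d` with the Euclidean norm. -/
abbrev Space (d : ℕ) : Type := EuclideanSpace ℝ (Fin d)

/-- The Hilbert space `L²(𝕋^d)`. -/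
abbrev L2Torus (d : ℕ) : Type := Lp ℂ 2 (volume : Measure (Torus d))

/-- The factor `(2π)^{-d/2}`. -/
def fourierConst (d : ℕ) : ℝ := (2 * Real.pi) ^ (-(d : ℝ) / 2)

/-- A lattice point `k ∈ ℤ^d` as a vector of `ℝ^d`. -/
def latticeVec {d : ℕ} (k : Fin d → ℤ) : Space d := WithLp.toLp 2 (fun i => (k i : ℝ))

/-- The function `x ↦ e^{i k·x}` on the torus. -/
def expMode {d : ℕ} (k : Fin d → ℤ) : C(Torus d, ℂ) where
  toFun x := ∏ i, fourier (k i) (x i)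
  continuous_toFun := by fun_prop

/-! ### Spaces of symbols -/

/-- `g ∈ L¹(ℝ^d)` is the Fourier transform of `f`, in the unitary normalization:
`f(ξ) = (2π)^{-d/2} ∫ g(η) e^{i η·ξ} dη` for every `ξ`. For continuous `f` and integrable `g` this
says exactly that the Fourier transform of `f` as a tempered distribution is `g`; the function `f`
itself need not be integrable. -/
def HasFourierTransform {d : ℕ} (f g : Space d → ℂ) : Prop :=
  Integrable g ∧
    ∀ ξ, f ξ = (fourierConst d : ℂ) * ∫ η, g η * Complex.exp (Complex.I * (⟪η, ξ⟫_ℝ : ℝ))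

/-- The norm `‖f‖_{𝒜_s(ℝ^d)} = (2π)^{-d/2} ∫ |f̂(η)| e^{s|η|} dη`, with value `∞` if `f̂` is not an
integrable function. As `f̂` is unique up to null sets, the infimum has at most one value. -/
def spaceNorm {d : ℕ} (s : ℝ) (f : Space d → ℂ) : ℝ≥0∞ :=
  ⨅ (g : Space d → ℂ) (_ : HasFourierTransform f g),
    ENNReal.ofReal (fourierConst d) * ∫⁻ η, ‖g η‖ₑ * ENNReal.ofReal (Real.exp (‖η‖ * s))

/-- Membership of a real function in `𝒜_s(ℝ^d)`. -/
structure MemSpaceAlg {d : ℕ} (s : ℝ) (f : Space d → ℝ) : Prop where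
  analytic : AnalyticOnNhd ℝ f univ
  norm_lt_top : spaceNorm s (fun ξ => (f ξ : ℂ)) < ∞

/-- The Fourier coefficient in `x` of a symbol on `T^*𝕋^d = 𝕋^d × ℝ^d`:
`â(k, ξ) = (2π)^{-d/2} ∫_{𝕋^d} a(x, ξ) e^{-i k·x} dx`. -/
def symbolCoeff {d : ℕ} (a : Torus d → Space d → ℂ) (k : Fin d → ℤ) (ξ : Space d) : ℂ :=
  (fourierConst d : ℂ) * ∫ x, a x ξ * expMode (-k) x

/-- The norm `‖a‖_{s,ρ} = (2π)^{-d/2} ∑_k ‖â(k, ·)‖_{𝒜_s(ℝ^d)} e^{ρ|k|}`. -/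
def symbolNorm {d : ℕ} (s ρ : ℝ) (a : Torus d → Space d → ℂ) : ℝ≥0∞ :=
  ENNReal.ofReal (fourierConst d) *
    ∑' k : Fin d → ℤ,
      spaceNorm s (symbolCoeff a k) * ENNReal.ofReal (Real.exp (‖latticeVec k‖ * ρ))

/-- Membership of a real function on `T^*𝕋^d` in `𝒜_{s,ρ}(T^*𝕋^d)`. Analyticity is that of the
lift to `ℝ^d × ℝ^d`, periodic in the first variable. -/
structure MemSymbolAlg {d : ℕ} (s ρ : ℝ) (V : Torus d → Space d → ℝ) : Prop where
  analytic : AnalyticOnNhd ℝ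
    (fun p : Space d × Space d => V (fun i => (p.1 i : AddCircle (2 * Real.pi))) p.2) univ
  norm_lt_top : symbolNorm s ρ (fun x ξ => (V x ξ : ℂ)) < ∞

/-! ### Operators on `L²(𝕋^d)` -/

/-- The orthonormal mode `e_k = (2π)^{-d/2} e^{i k·x}` in `L²(𝕋^d)`. -/
def modeLp {d : ℕ} (k : Fin d → ℤ) : L2Torus d :=
  (fourierConst d : ℂ) • ContinuousMap.toLp (E := ℂ) 2 volume ℂ (expMode k)

/-- The Fourier coefficient `ψ̂(k) = ⟨e_k, ψ⟩ = (2π)^{-d/2} ∫ ψ(x) e^{-i k·x} dx`. -/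
def coeffL2 {d : ℕ} (ψ : L2Torus d) (k : Fin d → ℤ) : ℂ := ⟪modeLp k, ψ⟫_ℂ

lemma coeffL2_add {d : ℕ} (ψ φ : L2Torus d) (k : Fin d → ℤ) :
    coeffL2 (ψ + φ) k = coeffL2 ψ k + coeffL2 φ k := inner_add_right _ _ _

lemma coeffL2_smul {d : ℕ} (c : ℂ) (ψ : L2Torus d) (k : Fin d → ℤ) :
    coeffL2 (c • ψ) k = c * coeffL2 ψ k := inner_smul_right _ _ _

lemma coeffL2_zero {d : ℕ} (k : Fin d → ℤ) : coeffL2 (0 : L2Torus d) k = 0 := inner_zero_right _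

/-- The graph of `L̂_{ω,ħ} = ω · ħ D_x`, `D_x = -i ∂_x`, on its maximal domain in `L²(𝕋^d)`: the
pairs `(ψ, φ)` with `φ̂(k) = ħ (ω·k) ψ̂(k)` for all `k`. -/
def freeGraph {d : ℕ} (ω : Space d) (h : ℝ) : Submodule ℂ (L2Torus d × L2Torus d) where
  carrier := {p | ∀ k, coeffL2 p.2 k = ((h * ⟪ω, latticeVec k⟫_ℝ : ℝ) : ℂ) * coeffL2 p.1 k}
  add_mem' := by
    intro p q hp hq k
    simp only [Prod.fst_add, Prod.snd_add, coeffL2_add, hp k, hq k, mul_add]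
  zero_mem' := by
    intro k
    simp [coeffL2_zero]
  smul_mem' := by
    intro c p hp k
    simp only [Prod.smul_fst, Prod.smul_snd, coeffL2_smul, hp k]
    ring

/-- The operator `L̂_{ω,ħ} = ω · ħ D_x` on `L²(𝕋^d)`. -/
def freeOp {d : ℕ} (ω : Space d) (h : ℝ) : L2Torus d →ₗ.[ℂ] L2Torus d :=
  (freeGraph ω h).toLinearPMap

/-- The matrix entry `⟨e_j, Op_ħ(a) e_k⟩ = (2π)^{-d/2} â(j - k, ħ (j + k) / 2)` of the semiclassical
Weyl quantization of `a`. -/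
def weylEntry {d : ℕ} (h : ℝ) (a : Torus d → Space d → ℂ) (j k : Fin d → ℤ) : ℂ :=
  (fourierConst d : ℂ) * symbolCoeff a (j - k) ((h / 2) • latticeVec (j + k))

/-- The graph of `Op_ħ(a)` on its maximal domain: the pairs `(ψ, φ)` in `L²(𝕋^d)` with
`φ̂(j) = ∑_k (2π)^{-d/2} â(j - k, ħ (j + k) / 2) ψ̂(k)` for all `j`, the sum being absolutely
convergent. -/
def weylGraph {d : ℕ} (h : ℝ) (a : Torus d → Space d → ℂ) :
    Submodule ℂ (L2Torus d × L2Torus d) where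
  carrier := {p | ∀ j, HasSum (fun k => weylEntry h a j k * coeffL2 p.1 k) (coeffL2 p.2 j)}
  add_mem' := by
    intro p q hp hq j
    simpa only [Prod.fst_add, Prod.snd_add, coeffL2_add, mul_add] using (hp j).add (hq j)
  zero_mem' := by
    intro j
    simp [coeffL2_zero]
  smul_mem' := by
    intro c p hp j
    simpa only [Prod.smul_fst, Prod.smul_snd, coeffL2_smul, mul_left_comm] using (hp j).mul_left c

/-- The semiclassical Weyl quantization `Op_ħ(a)` on `L²(𝕋^d)`. -/
def weylOp {d : ℕ} (h : ℝ) (a : Torus d → Space d → ℂ) : L2Torus d →ₗ.[ℂ] L2Torus d :=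
  (weylGraph h a).toLinearPMap

/-- The conjugate `U T U^*` of a partially defined operator `T` by a unitary operator `U`, with
domain `U (dom T)`; `U.symm` is the adjoint of `U`. -/
def unitaryConj {d : ℕ} (U : L2Torus d ≃ₗᵢ[ℂ] L2Torus d) (T : L2Torus d →ₗ.[ℂ] L2Torus d) :
    L2Torus d →ₗ.[ℂ] L2Torus d where
  domain := T.domain.comap (U.symm.toLinearEquiv : L2Torus d →ₗ[ℂ] L2Torus d)
  toFun := (U.toLinearEquiv : L2Torus d →ₗ[ℂ] L2Torus d) ∘ₗ T.toFun ∘ₗ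
    ((U.symm.toLinearEquiv : L2Torus d →ₗ[ℂ] L2Torus d).restrict
      (p := T.domain.comap (U.symm.toLinearEquiv : L2Torus d →ₗ[ℂ] L2Torus d))
      (fun _ hx => hx))

/-! ### The Diophantine condition -/

/-- `|k·ω| ≥ ς / |k|^{γ-1}` for all `k ∈ ℤ^d \ {0}`. -/
def IsDiophantine {d : ℕ} (ω : Space d) (ς γ : ℝ) : Prop :=
  ∀ k : Fin d → ℤ, k ≠ 0 → ς / ‖latticeVec k‖ ^ (γ - 1) ≤ |⟪latticeVec k, ω⟫_ℝ|

/-! ### Completeness of the modes; the two graphs are graphs of operators -/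

lemma expMode_neg {d : ℕ} (k : Fin d → ℤ) (x : Torus d) :
    expMode (-k) x = starRingEnd ℂ (expMode k x) := by
  simp only [expMode, Pi.neg_apply, fourier_neg, ContinuousMap.coe_mk, map_prod]

lemma expMode_single {d : ℕ} (z : Torus d) (i : Fin d) :
    expMode (Pi.single i 1) z = fourier 1 (z i) := by
  simp only [expMode, ContinuousMap.coe_mk]
  rw [Finset.prod_eq_single i]
  · simp
  · intro j _ hj
    simp [Pi.single_eq_of_ne hj]
  · simp

/-- The star subalgebra of `C(𝕋^d)` generated by the modes. -/
def modeSubalgebra (d : ℕ) : StarSubalgebra ℂ C(Torus d, ℂ) where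
  toSubalgebra := Algebra.adjoin ℂ (range expMode)
  star_mem' := by
    change Algebra.adjoin ℂ (range expMode) ≤ star (Algebra.adjoin ℂ (range expMode))
    refine Algebra.adjoin_le ?_
    rintro _ ⟨n, rfl⟩
    refine Algebra.subset_adjoin ⟨-n, ?_⟩
    ext1 x
    simp only [expMode_neg, starRingEnd_apply, ContinuousMap.star_apply]

theorem modeSubalgebra_coe (d : ℕ) :
    (modeSubalgebra d).toSubalgebra.toSubmodule = Submodule.span ℂ (range expMode) := by
  apply Algebra.adjoin_eq_span_of_subset
  refine .trans (fun x ↦ Submonoid.closure_induction (fun _ ↦ id) ⟨0, ?_⟩ ?_) Submodule.subset_span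
  · ext z
    simp [expMode]
  · rintro _ _ _ _ ⟨m, rfl⟩ ⟨n, rfl⟩
    refine ⟨m + n, ?_⟩
    ext z
    simp only [expMode, Pi.add_apply, fourier_add, Finset.prod_mul_distrib,
      ContinuousMap.coe_mk, ContinuousMap.mul_apply]

theorem modeSubalgebra_separatesPoints (d : ℕ) : (modeSubalgebra d).SeparatesPoints := by
  intro x y hxy
  obtain ⟨i, hi⟩ := Function.ne_iff.mp hxy
  refine ⟨_, ⟨expMode (Pi.single i 1), Algebra.subset_adjoin ⟨Pi.single i 1, rfl⟩, rfl⟩, ?_⟩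
  dsimp only
  rw [expMode_single, expMode_single, fourier_one, fourier_one]
  exact fun h => hi (AddCircle.injective_toCircle Real.two_pi_pos.ne' (Circle.coe_injective h))

theorem span_expMode_closure_eq_top (d : ℕ) :
    (Submodule.span ℂ (range (expMode (d := d)))).topologicalClosure = ⊤ := by
  rw [← modeSubalgebra_coe]
  exact congr_arg (Subalgebra.toSubmodule <| StarSubalgebra.toSubalgebra ·)
    (ContinuousMap.starSubalgebra_topologicalClosure_eq_top_of_separatesPoints _
      (modeSubalgebra_separatesPoints d))

theorem span_toLp_expMode_closure_eq_top (d : ℕ) :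
    (Submodule.span ℂ (range fun k : Fin d → ℤ =>
      ContinuousMap.toLp (E := ℂ) 2 (volume : Measure (Torus d)) ℂ
        (expMode k))).topologicalClosure = ⊤ := by
  simpa only [Submodule.map_span, ContinuousLinearMap.coe_coe, ← range_comp, Function.comp_def]
    using (ContinuousMap.toLp_denseRange ℂ (volume : Measure (Torus d)) ℂ (p := 2)
      ENNReal.ofNat_ne_top).topologicalClosure_map_submodule (span_expMode_closure_eq_top d)

/-- A function in `L²(𝕋^d)` is determined by its Fourier coefficients. -/
theorem eq_zero_of_coeffL2_eq_zero {d : ℕ} (ψ : L2Torus d) (hψ : ∀ k, coeffL2 ψ k = 0) :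
    ψ = 0 := by
  have hc : (fourierConst d : ℂ) ≠ 0 := by
    have : 0 < fourierConst d := Real.rpow_pos_of_pos Real.two_pi_pos _
    exact_mod_cast this.ne'
  have hd := (Submodule.dense_iff_topologicalClosure_eq_top).mpr
    (span_toLp_expMode_closure_eq_top d)
  refine Dense.eq_zero_of_inner_left (𝕜 := ℂ) hd ?_
  intro v hv
  refine inner_eq_zero_symm.mp ?_
  induction hv using Submodule.span_induction with
  | mem x hx =>
    obtain ⟨k, rfl⟩ := hx
    have h := hψ k
    rw [coeffL2, modeLp, inner_smul_left] at h
    exact (mul_eq_zero.mp h).resolve_left (by simpa using hc)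
  | zero => exact inner_zero_left _
  | add x y _ _ hx hy => rw [inner_add_left, hx, hy, add_zero]
  | smul c x _ hx => rw [inner_smul_left, hx, mul_zero]

theorem freeOp_graph {d : ℕ} (ω : Space d) (h : ℝ) : (freeOp ω h).graph = freeGraph ω h := by
  refine Submodule.toLinearPMap_graph_eq _ ?_
  rintro ⟨ψ, φ⟩ hp h0
  refine eq_zero_of_coeffL2_eq_zero _ fun k => ?_
  simp only at h0
  rw [hp k]
  simp only [h0, coeffL2_zero, mul_zero]

theorem weylOp_graph {d : ℕ} (h : ℝ) (a : Torus d → Space d → ℂ) :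
    (weylOp h a).graph = weylGraph h a := by
  refine Submodule.toLinearPMap_graph_eq _ ?_
  rintro ⟨ψ, φ⟩ hp h0
  refine eq_zero_of_coeffL2_eq_zero _ fun j => ?_
  simp only at h0
  have := hp j
  simp only [h0, coeffL2_zero, mul_zero] at this
  exact this.unique hasSum_zero

end

end QuantumKAM

/-! Divide by ħ. In the basis `e_k` the free operator becomes diagonal with eigenvalues ω·k, and
Op_ħ(V) has entries v_{j-k}(ħj) with v_k(ξ) = (2π)^{-d/2} V̂(k, ξ - ħk/2). It is thus the image of ∑
v_k u_k in the crossed product ℓ¹(ℤ^d; ℂ ⊕ 𝒜_s), where u_k translates functions by ħk, and the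
commutator with the free operator is the derivation a_k ↦ (ω·k) a_k. The estimates take place in
this Banach algebra with weights e^{σ|k|}. Translations are isometric, so no bound depends on ħ.

There W (L + V - R) W⁻¹ = L is solved by a Newton scheme (`NewtonStage.step`, `exists_counterterm`).
If W (L + V - R) W⁻¹ = L + E, first change R by r so that E' = E - W r W⁻¹ has mean zero; as W is
near 1 this is a contraction problem (`exists_mean_eq`). Then solve [L, F] = E' (`exists_primitive`)
and conjugate by 1 + F: the new error F E' (1 + F)⁻¹ is quadratic in E. The Diophantine condition
costs a factor e^{(n+1)(n+2)/28} at step n when the radius is ρ/(n+1) (`small_divisor_bound`), which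
the quadratic convergence absorbs. The constants are adjoined only to have a unit: the constant term
of R vanishes because V has none (`exists_counterterm_fourierAlg`).

Next the algebra is represented on L² (`crossedOp_mul`). The scheme is not symmetric, so reality and
unitarity are recovered afterwards from the relation [L, W] = W (A - D), with A = Op_ħ(V) and D the
diagonal counterterm. The diagonal of [L, W W*] is zero, which forces D* = D
(`counterterm_selfAdjoint`). Then W W* commutes with L, so it is diagonal by nonresonance, and U =
(W W*)^{-1/2} W is a unitary solving the same equation (`exists_unitary`). Only the values of R on
ħℤ^d enter the operator, so R may be replaced by its real part. Finally U and U* have bounded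
commutators with L, hence preserve its domain (`unitaryConj_freeOp_add`). -/

namespace QuantumKAM

set_option linter.unusedSectionVars false

noncomputable section

/-! ### The crossed product `ℓ¹(G; B)` -/

/-- An action of a group by isometric automorphisms of a complex Banach algebra. -/
structure IsoAction (G B : Type*) [AddCommGroup G] [NormedRing B] [NormedAlgebra ℂ B] where
  toFun : G → B →ₐ[ℂ] B
  map_zero : ∀ b, toFun 0 b = b
  map_add : ∀ g h b, toFun (g + h) b = toFun g (toFun h b)
  norm_map : ∀ g b, ‖toFun g b‖ = ‖b‖

variable {G B : Type*} [AddCommGroup G] [NormedRing B] [NormedAlgebra ℂ B]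

/-- The continuous linear map underlying an automorphism of the action. -/
def IsoAction.clm (T : IsoAction G B) (g : G) : B →L[ℂ] B :=
  (T.toFun g).toLinearMap.mkContinuous 1 fun b => by simp [T.norm_map]

/-- The crossed product of `B` with `G`: summable families `(a_k)`, standing for `∑ a_k u_k`,
with `u_k b = T_k(b) u_k`. -/
def Crossed (_T : IsoAction G B) : Type _ := lp (fun _ : G => B) 1

namespace Crossed

variable {T : IsoAction G B}

instance : NormedAddCommGroup (Crossed T) := inferInstanceAs (NormedAddCommGroup (lp _ 1))

instance [CompleteSpace B] : CompleteSpace (Crossed T) :=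
  inferInstanceAs (CompleteSpace (lp (fun _ : G => B) 1))

/-- The coefficients `a_k` of `∑ a_k u_k`. -/
def coeff (a : Crossed T) : G → B := a.1

instance : CoeFun (Crossed T) fun _ => G → B := ⟨coeff⟩

@[ext] lemma ext {a b : Crossed T} (h : ∀ k, a k = b k) : a = b := lp.ext (funext h)

@[simp] lemma add_apply (a b : Crossed T) (k : G) : (a + b) k = a k + b k := rfl
@[simp] lemma sub_apply (a b : Crossed T) (k : G) : (a - b) k = a k - b k := rfl
@[simp] lemma neg_apply (a : Crossed T) (k : G) : (-a) k = -a k := rfl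
@[simp] lemma zero_apply (k : G) : (0 : Crossed T) k = 0 := rfl

lemma summable_norm (a : Crossed T) : Summable fun k => ‖a k‖ := by
  have := (lp.memℓp a).summable (by simp)
  simp only [ENNReal.toReal_one, Real.rpow_one] at this
  exact this

lemma norm_eq (a : Crossed T) : ‖a‖ = ∑' k, ‖a k‖ := by
  have := lp.norm_eq_tsum_rpow (p := 1) (by simp) a
  simp only [ENNReal.toReal_one, Real.rpow_one, one_div, inv_one] at this
  exact this

lemma norm_apply_le (a : Crossed T) (k : G) : ‖a k‖ ≤ ‖a‖ :=
  lp.norm_apply_le_norm one_ne_zero a k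

lemma enorm_eq (a : Crossed T) : ‖a‖ₑ = ∑' k, ‖a k‖ₑ := by
  rw [← ofReal_norm, norm_eq, ENNReal.ofReal_tsum_of_nonneg (fun _ => norm_nonneg _)
    a.summable_norm]
  simp [ofReal_norm]

/-- A summable family as an element of the crossed product. -/
def mk (T : IsoAction G B) (f : G → B) (hf : ∑' k, ‖f k‖ₑ ≠ ∞) : Crossed T :=
  ⟨f, memℓp_gen (by
    simp only [ENNReal.toReal_one, Real.rpow_one]
    have := ENNReal.summable_toReal hf
    simpa [toReal_enorm] using this)⟩

@[simp] lemma mk_apply (f : G → B) (hf : ∑' k, ‖f k‖ₑ ≠ ∞) (k : G) : mk T f hf k = f k := rfl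

lemma enorm_map (g : G) (b : B) : ‖T.toFun g b‖ₑ = ‖b‖ₑ := by
  rw [← ofReal_norm, T.norm_map, ofReal_norm]

lemma enorm_mul_le' (b c : B) : ‖b * c‖ₑ ≤ ‖b‖ₑ * ‖c‖ₑ := by
  simp only [enorm_eq_nnnorm]
  exact_mod_cast nnnorm_mul_le b c

/-- The coefficients of a product. -/
def conv (T : IsoAction G B) (a b : G → B) (k : G) : B := ∑' m, a m * T.toFun m (b (k - m))

/-- The weighted `ℓ¹` norm. -/
def wnorm (w : G → ℝ≥0∞) (a : G → B) : ℝ≥0∞ := ∑' k, ‖a k‖ₑ * w k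

/-- Young's inequality for ℓ¹: the action is isometric, so the twist does not affect norms, and the
submultiplicative weight splits over the two factors. -/
lemma wnorm_conv_le (w : G → ℝ≥0∞) (hw : ∀ k l, w (k + l) ≤ w k * w l) (a b : G → B) :
    wnorm w (conv T a b) ≤ wnorm w a * wnorm w b := by
  calc wnorm w (conv T a b)
      ≤ ∑' k, ∑' m, (‖a m‖ₑ * w m) * (‖b (k - m)‖ₑ * w (k - m)) := by
        refine ENNReal.tsum_le_tsum fun k => ?_
        rw [conv]
        calc _ ≤ (∑' m, ‖a m * T.toFun m (b (k - m))‖ₑ) * w k := by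
              gcongr; exact enorm_tsum_le_tsum_enorm
          _ = ∑' m, ‖a m * T.toFun m (b (k - m))‖ₑ * w k := ENNReal.tsum_mul_right.symm
          _ ≤ _ := by
              refine ENNReal.tsum_le_tsum fun m => ?_
              calc _ ≤ (‖a m‖ₑ * ‖b (k - m)‖ₑ) * (w m * w (k - m)) := by
                    gcongr
                    · exact (enorm_mul_le' _ _).trans (by rw [enorm_map])
                    · simpa using hw m (k - m)
                _ = _ := by ring
    _ = ∑' m, ∑' k, (‖a m‖ₑ * w m) * (‖b (k - m)‖ₑ * w (k - m)) := ENNReal.tsum_comm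
    _ = ∑' m, (‖a m‖ₑ * w m) * wnorm w b := by
        refine tsum_congr fun m => ?_
        rw [ENNReal.tsum_mul_left]
        congr 1
        exact (Equiv.subRight m).tsum_eq (fun k => ‖b k‖ₑ * w k)
    _ = _ := ENNReal.tsum_mul_right

lemma wnorm_one (a : Crossed T) : wnorm (fun _ => 1) a = ‖a‖ₑ := by
  simp [wnorm, enorm_eq]

variable [CompleteSpace B]

lemma summable_term (a b : Crossed T) (k : G) :
    Summable fun m => a m * T.toFun m (b (k - m)) := by
  refine .of_norm_bounded (a.summable_norm.mul_right ‖b‖) fun m => ?_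
  refine (norm_mul_le _ _).trans ?_
  rw [T.norm_map]
  gcongr
  exact norm_apply_le _ _

instance : Mul (Crossed T) where
  mul a b := mk T (conv T a b) (by
    have h := wnorm_conv_le (T := T) (fun _ => 1) (by simp) a b
    rw [wnorm_one, wnorm_one] at h
    simp only [wnorm, mul_one] at h
    exact (h.trans_lt (ENNReal.mul_lt_top enorm_lt_top enorm_lt_top)).ne)

lemma mul_apply (a b : Crossed T) (k : G) :
    (a * b) k = ∑' m, a m * T.toFun m (b (k - m)) := rfl

lemma hasSum_mul_apply (a b : Crossed T) (k : G) :
    HasSum (fun m => a m * T.toFun m (b (k - m))) ((a * b) k) :=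
  (summable_term a b k).hasSum

lemma norm_mul_le' (a b : Crossed T) : ‖a * b‖ ≤ ‖a‖ * ‖b‖ := by
  have h := wnorm_conv_le (T := T) (fun _ => 1) (by simp) a b
  rw [wnorm_one, wnorm_one] at h
  have h' : ‖a * b‖ₑ ≤ ‖a‖ₑ * ‖b‖ₑ := by
    rw [← wnorm_one]; exact h
  simpa using ENNReal.toReal_mono (by finiteness) h'

open Classical in
/-- The element `b u_0`. -/
def diag (T : IsoAction G B) (b : B) : Crossed T := lp.single (E := fun _ : G => B) 1 0 b

open Classical in
lemma diag_apply (b : B) (k : G) : diag T b k = if k = 0 then b else 0 := by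
  refine (lp.single_apply (E := fun _ : G => B) 1 0 b k).trans ?_
  simp [Pi.single_apply]

@[simp] lemma diag_apply_zero (b : B) : diag T b 0 = b := by simp [diag_apply]

lemma diag_apply_ne (b : B) {k : G} (hk : k ≠ 0) : diag T b k = 0 := by simp [diag_apply, hk]

@[simp] lemma norm_diag (b : B) : ‖diag T b‖ = ‖b‖ := by
  classical
  exact lp.norm_single (E := fun _ : G => B) (by simp) _ _

lemma diag_mul_apply (b : B) (a : Crossed T) (k : G) : (diag T b * a) k = b * a k := by
  rw [mul_apply, tsum_eq_single 0]
  · simp [T.map_zero]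
  · intro m hm; simp [diag_apply_ne b hm]

lemma mul_diag_apply (b : B) (a : Crossed T) (k : G) : (a * diag T b) k = a k * T.toFun k b := by
  rw [mul_apply, tsum_eq_single k]
  · simp
  · intro m hm; rw [diag_apply_ne b (sub_ne_zero.mpr hm.symm), map_zero, mul_zero]

instance : One (Crossed T) := ⟨diag T 1⟩

lemma one_def : (1 : Crossed T) = diag T 1 := rfl

lemma mul_assoc' (a b c : Crossed T) : a * b * c = a * (b * c) := by
  ext k
  have hS : Summable fun p : G × G =>
      a p.1 * T.toFun p.1 (b (p.2 - p.1)) * T.toFun p.2 (c (k - p.2)) := by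
    -- The shear (m, l) ↦ (m, l - m) turns the dominating family into a product of two summable
    -- ones, which justifies exchanging the two sums.
    let e : G × G ≃ G × G := (Equiv.refl G).prodShear (fun l => Equiv.subRight l)
    have h1 : Summable fun p : G × G => ‖a p.1‖ * ‖b p.2‖ :=
      a.summable_norm.mul_of_nonneg b.summable_norm (fun _ => norm_nonneg _)
        (fun _ => norm_nonneg _)
    have h2 : Summable fun p : G × G => ‖a p.1‖ * ‖b (p.2 - p.1)‖ := e.summable_iff.mpr h1
    refine .of_norm_bounded (h2.mul_right ‖c‖) fun p => ?_
    refine (norm_mul_le _ _).trans ?_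
    rw [T.norm_map]
    gcongr
    · exact (norm_mul_le _ _).trans (by rw [T.norm_map])
    · exact norm_apply_le _ _
  rw [mul_apply, mul_apply]
  have e1 : ∀ m, (a * b) m * T.toFun m (c (k - m)) =
      ∑' l, a l * T.toFun l (b (m - l)) * T.toFun m (c (k - m)) := fun m => by
    rw [mul_apply, (summable_term a b m).tsum_mul_right]
  have e2 : ∀ l, a l * T.toFun l ((b * c) (k - l)) =
      ∑' m, a l * T.toFun l (b (m - l)) * T.toFun m (c (k - m)) := fun l => by
    rw [mul_apply]
    have : T.toFun l (∑' m, b m * T.toFun m (c (k - l - m))) =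
        ∑' m, T.toFun l (b m * T.toFun m (c (k - l - m))) :=
      (T.clm l).map_tsum (summable_term b c (k - l))
    rw [this, ← Summable.tsum_mul_left]
    · rw [← (Equiv.subRight l).tsum_eq]
      refine tsum_congr fun m => ?_
      rw [map_mul, ← T.map_add]
      simp only [Equiv.subRight_apply, mul_assoc]
      rw [show k - l - (m - l) = k - m by abel, show l + (m - l) = m by abel]
    · exact (T.clm l).summable (summable_term b c (k - l))
  simp_rw [e1, e2]
  exact hS.tsum_comm (f := fun l m => a l * T.toFun l (b (m - l)) * T.toFun m (c (k - m)))

instance : NormedRing (Crossed T) where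
  __ := (inferInstance : NormedAddCommGroup (Crossed T))
  mul_assoc := mul_assoc'
  one_mul a := by ext k; rw [one_def, diag_mul_apply, one_mul]
  mul_one a := by ext k; rw [one_def, mul_diag_apply, map_one, mul_one]
  zero_mul a := by ext k; rw [mul_apply]; simp
  mul_zero a := by ext k; rw [mul_apply]; simp
  left_distrib a b c := by
    ext k
    rw [add_apply, mul_apply, mul_apply, mul_apply,
      ← (summable_term a b k).tsum_add (summable_term a c k)]
    exact tsum_congr fun m => by rw [add_apply, map_add, mul_add]
  right_distrib a b c := by
    ext k
    rw [add_apply, mul_apply, mul_apply, mul_apply,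
      ← (summable_term a c k).tsum_add (summable_term b c k)]
    exact tsum_congr fun m => by rw [add_apply, add_mul]
  norm_mul_le := norm_mul_le'

lemma diag_add (b c : B) : diag T (b + c) = diag T b + diag T c := by
  ext k; by_cases hk : k = 0
  · subst hk; simp
  · simp [diag_apply_ne _ hk]

lemma diag_sub (b c : B) : diag T (b - c) = diag T b - diag T c := by
  ext k; by_cases hk : k = 0
  · subst hk; simp
  · simp [diag_apply_ne _ hk]

/-- The Leibniz rule for the derivation `a_k ↦ lam k • a_k`. -/
lemma leibniz (lam : G →+ ℝ) {a b a' b' : Crossed T} (ha : ∀ k, a' k = (lam k : ℂ) • a k)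
    (hb : ∀ k, b' k = (lam k : ℂ) • b k) (k : G) :
    (a' * b + a * b') k = (lam k : ℂ) • (a * b) k := by
  rw [add_apply, mul_apply, mul_apply, mul_apply,
    ← (summable_term a' b k).tsum_add (summable_term a b' k),
    ← (summable_term a b k).tsum_const_smul]
  refine tsum_congr fun m => ?_
  rw [ha, hb, map_smul, smul_mul_assoc, mul_smul_comm, ← add_smul]
  congr 1
  rw [map_sub]; push_cast; ring

/-! ### Weighted norms -/

/-- `a` has weighted `ℓ¹` norm at most `C`, the weight being `e^{σ ℓ(k)}`. -/
def Bd (ℓ : G → ℝ) (σ : ℝ) (a : Crossed T) (C : ℝ) : Prop :=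
  wnorm (fun k => ENNReal.ofReal (Real.exp (ℓ k * σ))) a ≤ ENNReal.ofReal C

variable {ℓ : G → ℝ} {σ : ℝ} {a b : Crossed T} {C C' : ℝ}

lemma Bd.add (hC : 0 ≤ C) (hC' : 0 ≤ C') (ha : Bd ℓ σ a C) (hb : Bd ℓ σ b C') :
    Bd ℓ σ (a + b) (C + C') := by
  rw [Bd, ENNReal.ofReal_add hC hC']
  refine le_trans ?_ (add_le_add ha hb)
  unfold wnorm
  rw [← ENNReal.tsum_add]
  refine ENNReal.tsum_le_tsum fun k => ?_
  rw [← add_mul]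
  gcongr
  exact enorm_add_le _ _

lemma Bd.neg (ha : Bd ℓ σ a C) : Bd ℓ σ (-a) C := by
  have : wnorm (fun k => ENNReal.ofReal (Real.exp (ℓ k * σ))) (-a : Crossed T) =
      wnorm (fun k => ENNReal.ofReal (Real.exp (ℓ k * σ))) a := by
    simp [wnorm]
  rw [Bd, this]
  exact ha

lemma Bd.sub (hC : 0 ≤ C) (hC' : 0 ≤ C') (ha : Bd ℓ σ a C) (hb : Bd ℓ σ b C') :
    Bd ℓ σ (a - b) (C + C') := by
  rw [sub_eq_add_neg]; exact ha.add hC hC' hb.neg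

lemma Bd.mul (hℓ : ∀ k l, ℓ (k + l) ≤ ℓ k + ℓ l) (hσ : 0 ≤ σ) (hC : 0 ≤ C) (ha : Bd ℓ σ a C)
    (hb : Bd ℓ σ b C') : Bd ℓ σ (a * b) (C * C') := by
  rw [Bd, ENNReal.ofReal_mul hC]
  refine le_trans (wnorm_conv_le _ (fun k l => ?_) a b) (mul_le_mul' ha hb)
  rw [← ENNReal.ofReal_mul (Real.exp_pos _).le, ← Real.exp_add, ← add_mul]
  gcongr
  exact hℓ k l

lemma Bd.mono {σ' : ℝ} (hℓ : ∀ k, 0 ≤ ℓ k) (hσ : σ' ≤ σ) (hC : C ≤ C') (ha : Bd ℓ σ a C) :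
    Bd ℓ σ' a C' := by
  refine le_trans (le_trans ?_ ha) (ENNReal.ofReal_le_ofReal hC)
  refine ENNReal.tsum_le_tsum fun k => ?_
  dsimp only
  gcongr
  exact hℓ k

lemma Bd.norm_le (hℓ : ∀ k, 0 ≤ ℓ k) (hσ : 0 ≤ σ) (hC : 0 ≤ C) (ha : Bd ℓ σ a C) : ‖a‖ ≤ C := by
  have h : ‖a‖ₑ ≤ ENNReal.ofReal C := by
    rw [← wnorm_one]
    refine le_trans (ENNReal.tsum_le_tsum fun k => ?_) ha
    gcongr
    rw [ENNReal.one_le_ofReal]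
    exact Real.one_le_exp (mul_nonneg (hℓ k) hσ)
  simpa [hC] using ENNReal.toReal_mono (by finiteness) h

lemma Bd.norm_apply_le (hℓ : ∀ k, 0 ≤ ℓ k) (hσ : 0 ≤ σ) (hC : 0 ≤ C) (ha : Bd ℓ σ a C) (k : G) :
    ‖a k‖ ≤ C :=
  (Crossed.norm_apply_le a k).trans (ha.norm_le hℓ hσ hC)

lemma bd_diag (hℓ : ℓ 0 = 0) (r : B) : Bd ℓ σ (diag T r) ‖r‖ := by
  unfold Bd wnorm
  rw [tsum_eq_single 0]
  · simp [hℓ]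
  · intro k hk; simp [diag_apply_ne r hk]

/-- Convergence is assumed in the unweighted norm only; the weighted bound follows coefficient by
coefficient from Tonelli. -/
lemma bd_tsum {x : ℕ → Crossed T} (hx : Summable x) {c : ℕ → ℝ} (hc : ∀ n, 0 ≤ c n)
    (hcs : Summable c) (h : ∀ n, Bd ℓ σ (x n) (c n)) : Bd ℓ σ (∑' n, x n) (∑' n, c n) := by
  rw [Bd, ENNReal.ofReal_tsum_of_nonneg hc hcs]
  refine le_trans ?_ (ENNReal.tsum_le_tsum h)
  simp only [wnorm]
  rw [ENNReal.tsum_comm]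
  refine ENNReal.tsum_le_tsum fun k => ?_
  rw [ENNReal.tsum_mul_right]
  gcongr
  have : (∑' n, x n) k = ∑' n, x n k := by
    have := hx.hasSum.map (lp.evalCLM ℂ (fun _ : G => B) 1 k)
      (lp.evalCLM ℂ (fun _ : G => B) 1 k).continuous
    exact this.tsum_eq.symm
  rw [this]
  exact enorm_tsum_le_tsum_enorm

lemma Bd.pow_succ (hℓ : ∀ k l, ℓ (k + l) ≤ ℓ k + ℓ l) (hσ : 0 ≤ σ) (hC : 0 ≤ C)
    (ha : Bd ℓ σ a C) (n : ℕ) : Bd ℓ σ (a ^ (n + 1)) (C ^ (n + 1)) := by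
  induction n with
  | zero => simpa using ha
  | succ n ih =>
    rw [_root_.pow_succ, _root_.pow_succ C]
    exact ih.mul hℓ hσ (by positivity) ha

/-- Inversion of `1 + F` by the Neumann series, in the weighted norm. -/
lemma exists_inverse (hℓ0 : ∀ k, 0 ≤ ℓ k) (hℓ : ∀ k l, ℓ (k + l) ≤ ℓ k + ℓ l) (hσ : 0 ≤ σ)
    {f : ℝ} (hf : 0 ≤ f) (hf1 : f < 1) {F : Crossed T} (hF : Bd ℓ σ F f) :
    ∃ Y : Crossed T, (1 + F) * Y = 1 ∧ Y * (1 + F) = 1 ∧ Bd ℓ σ (Y - 1) (f / (1 - f)) := by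
  have hn : ‖-F‖ < 1 := by rw [norm_neg]; exact (hF.norm_le hℓ0 hσ hf).trans_lt hf1
  refine ⟨∑' n, (-F) ^ n, ?_, ?_, ?_⟩
  · have := mul_neg_geom_series (-F) hn
    rwa [sub_neg_eq_add] at this
  · have := geom_series_mul_neg (-F) hn
    rwa [sub_neg_eq_add] at this
  · have hs := summable_geometric_of_norm_lt_one hn
    have h1 : ∑' n, (-F) ^ n - 1 = ∑' n, (-F) ^ (n + 1) := by
      rw [hs.tsum_eq_zero_add]; simp
    have h2 : f / (1 - f) = ∑' n : ℕ, f ^ (n + 1) := by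
      simp_rw [pow_succ]
      rw [tsum_mul_right, tsum_geometric_of_lt_one hf hf1]; field_simp
    rw [h1, h2]
    refine bd_tsum ((summable_nat_add_iff 1).mpr hs) (fun n => by positivity)
      ((summable_nat_add_iff 1).mpr (summable_geometric_of_lt_one hf hf1)) fun n => ?_
    exact hF.neg.pow_succ hℓ hσ hf n

/-- The solution `F` of `lam k • F_k = E_k` for `E` of zero mean. -/
lemma exists_primitive {lam : G →+ ℝ} {σ' K : ℝ} (hK : 0 ≤ K) (hlam : ∀ k, k ≠ 0 → lam k ≠ 0)
    (hsd : ∀ k, k ≠ 0 → Real.exp (-(ℓ k * (σ - σ'))) ≤ K * |lam k|)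
    (hℓ0 : ∀ k, 0 ≤ ℓ k) (hσ' : 0 ≤ σ') {E : Crossed T} {e : ℝ} 
    (hE : Bd ℓ σ E e) (hE0 : E 0 = 0) :
    ∃ F : Crossed T, (∀ k, E k = (lam k : ℂ) • F k) ∧ Bd ℓ σ' F (K * e) := by
  -- At k = 0 the divisor is zero and its inverse is zero by convention, so F has mean zero; this is
  -- consistent because E has mean zero.
  let f : G → B := fun k => ((lam k : ℂ)⁻¹) • E k
  have hb : wnorm (fun k => ENNReal.ofReal (Real.exp (ℓ k * σ'))) f ≤ ENNReal.ofReal (K * e) := by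
    rw [ENNReal.ofReal_mul hK]
    refine le_trans ?_ (mul_le_mul_right hE _)
    unfold wnorm
    rw [← ENNReal.tsum_mul_left]
    refine ENNReal.tsum_le_tsum fun k => ?_
    by_cases hk : k = 0
    · simp [f, hk, hE0]
    · have hl := abs_pos.mpr (hlam k hk)
      have : ‖f k‖ₑ = ENNReal.ofReal (|lam k|⁻¹) * ‖E k‖ₑ := by
        simp only [f]
        rw [enorm_smul, ← ofReal_norm]
        simp
      rw [this]
      calc _ = ENNReal.ofReal (|lam k|⁻¹ * Real.exp (ℓ k * σ')) * ‖E k‖ₑ := by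
            rw [ENNReal.ofReal_mul (by positivity)]; ring
        _ ≤ ENNReal.ofReal (K * Real.exp (ℓ k * σ)) * ‖E k‖ₑ := by
            refine mul_le_mul' (ENNReal.ofReal_le_ofReal ?_) le_rfl
            have h1 : Real.exp (ℓ k * σ') = Real.exp (-(ℓ k * (σ - σ'))) * Real.exp (ℓ k * σ) := by
              rw [← Real.exp_add]; congr 1; ring
            rw [h1, ← mul_assoc]
            gcongr
            rw [inv_mul_le_iff₀ hl, mul_comm |lam k|]
            exact hsd k hk
        _ = _ := by rw [ENNReal.ofReal_mul hK]; ring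
  have hf : ∑' k, ‖f k‖ₑ ≠ ∞ := by
    refine (lt_of_le_of_lt (le_trans (ENNReal.tsum_le_tsum fun k => ?_) hb)
      ENNReal.ofReal_lt_top).ne
    refine le_mul_of_one_le_right zero_le ?_
    rw [ENNReal.one_le_ofReal]
    exact Real.one_le_exp (mul_nonneg (hℓ0 k) hσ')
  refine ⟨mk T f hf, fun k => ?_, hb⟩
  simp only [mk_apply, f]
  by_cases hk : k = 0
  · simp [hk, hE0]
  · rw [smul_inv_smul₀]
    exact_mod_cast hlam k hk

/-- Solution `r ∈ B` of `⟨W r Z⟩ = e` for `W`, `Z` close to `1`, where `⟨·⟩` is the mean. -/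
lemma exists_mean_eq {w c : ℝ} (hc : (1 + w) ^ 2 - 1 ≤ c) (hc1 : c < 1) (hw : 0 ≤ w)
    {W Z : Crossed T} (hW : ‖W - 1‖ ≤ w) (hZ : ‖Z - 1‖ ≤ w) (e : B) :
    ∃ r : B, (W * diag T r * Z) 0 = e ∧ ‖r‖ ≤ ‖e‖ / (1 - c) := by
  have hc0 : 0 ≤ c := le_trans (by nlinarith) hc
  -- Expanding W r Z around W = Z = 1 leaves three terms, of total norm at most (w² + 2w)‖r‖ = ((1 +
  -- w)² - 1)‖r‖.
  have key : ∀ r : B, ‖r - (W * diag T r * Z) 0‖ ≤ c * ‖r‖ := fun r => by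
    have h1 : r - (W * diag T r * Z) 0 = (-((W - 1) * diag T r * (Z - 1) + (W - 1) * diag T r
        + diag T r * (Z - 1))) 0 := by
      have : -((W - 1) * diag T r * (Z - 1) + (W - 1) * diag T r
        + diag T r * (Z - 1)) = diag T r - W * diag T r * Z := by noncomm_ring
      rw [this]; simp
    rw [h1]
    refine (norm_apply_le _ _).trans ?_
    rw [norm_neg]
    have n1 : ‖(W - 1) * diag T r * (Z - 1)‖ ≤ w * ‖r‖ * w := by
      refine (norm_mul_le _ _).trans ?_
      gcongr
      refine (norm_mul_le _ _).trans ?_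
      rw [norm_diag]; gcongr
    have n2 : ‖(W - 1) * diag T r‖ ≤ w * ‖r‖ := by
      refine (norm_mul_le _ _).trans ?_
      rw [norm_diag]; gcongr
    have n3 : ‖diag T r * (Z - 1)‖ ≤ ‖r‖ * w := by
      refine (norm_mul_le _ _).trans ?_
      rw [norm_diag]; gcongr
    refine (norm_add₃_le).trans ((add_le_add_three n1 n2 n3).trans ?_)
    nlinarith [norm_nonneg r]
  -- A fixed point of this affine map is a solution, and its linear part is the one estimated in
  -- `key`.
  let Φ : B → B := fun r => e + (r - (W * diag T r * Z) 0)
  have hΦ : ContractingWith ⟨c, hc0⟩ Φ := by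
    refine ⟨by exact_mod_cast hc1, LipschitzWith.of_dist_le_mul fun r r' => ?_⟩
    rw [dist_eq_norm, dist_eq_norm]
    have : Φ r - Φ r' = (r - r') - (W * diag T (r - r') * Z) 0 := by
      simp only [Φ, diag_sub, mul_sub, sub_mul, sub_apply]
      abel
    rw [this]
    exact key _
  obtain ⟨r, hr⟩ : ∃ r, Φ r = r := ⟨_, hΦ.fixedPoint_isFixedPt⟩
  have hr' : (W * diag T r * Z) 0 = e := by
    have : e + (r - (W * diag T r * Z) 0) = r := hr
    have h2 : e - (W * diag T r * Z) 0 = 0 := by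
      rw [← sub_eq_zero.mpr this]; abel
    exact (sub_eq_zero.mp h2).symm
  refine ⟨r, hr', ?_⟩
  rw [le_div_iff₀ (by linarith)]
  have h1 := key r
  rw [hr'] at h1
  have h2 : ‖r‖ ≤ ‖r - e‖ + ‖e‖ := by simpa using norm_add_le (r - e) e
  linarith

end Crossed

end

noncomputable section

/-! ### Scalar estimates for the Newton scheme -/

/-- Put x = uρ/(mτ) and y = m/(4τ), so that the power equals exp(τ(log x + log y)). The bound log x
≤ x - 1 produces exactly the uρ/m of the exponential, and log y ≤ y/e² + 1 ≤ y/7 + 1 leaves τy/7 =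
m/28. Splitting the product this way makes the loss depend on m alone, not on ρ or τ. -/
lemma small_divisor_bound {τ ρ u m : ℝ} (hτ : 0 < τ) (hρ : 0 < ρ) (hu : 0 < u) (hm : 0 < m) :
    u ^ τ * (Real.sqrt ρ / (2 * τ)) ^ (2 * τ) * Real.exp (-(u * (ρ / m))) ≤ Real.exp (m / 28) := by
  have h1 : (Real.sqrt ρ / (2 * τ)) ^ (2 * τ) = (ρ / (4 * τ ^ 2)) ^ τ := by
    rw [Real.rpow_mul (by positivity), Real.rpow_two, div_pow, Real.sq_sqrt hρ.le]
    congr 1; ring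
  have h2 : u ^ τ * (ρ / (4 * τ ^ 2)) ^ τ =
      Real.exp (τ * (Real.log (u * ρ / (m * τ)) + Real.log (m / (4 * τ)))) := by
    rw [← Real.mul_rpow hu.le (by positivity), ← Real.log_mul (by positivity) (by positivity),
      Real.rpow_def_of_pos (by positivity), mul_comm τ]
    congr 3
    field_simp
  rw [h1, h2, ← Real.exp_add, Real.exp_le_exp]
  have l1 : Real.log (u * ρ / (m * τ)) ≤ u * ρ / (m * τ) - 1 :=
    Real.log_le_sub_one_of_pos (by positivity)
  have l2 : Real.log (m / (4 * τ)) ≤ m / (4 * τ) / 7 + 1 := by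
    have := Real.log_le_sub_one_of_pos (x := m / (4 * τ) / Real.exp 2) (by positivity)
    rw [Real.log_div (by positivity) (by positivity), Real.log_exp] at this
    have h7 : (7 : ℝ) ≤ Real.exp 2 := by
      have := Real.exp_one_gt_d9
      rw [show (2 : ℝ) = 1 + 1 by norm_num, Real.exp_add]
      nlinarith
    have : m / (4 * τ) / Real.exp 2 ≤ m / (4 * τ) / 7 := by gcongr
    linarith
  have l3 : τ * (Real.log (u * ρ / (m * τ)) + Real.log (m / (4 * τ))) ≤
      τ * ((u * ρ / (m * τ) - 1) + (m / (4 * τ) / 7 + 1)) := by gcongr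
  have l4 : τ * ((u * ρ / (m * τ) - 1) + (m / (4 * τ) / 7 + 1)) = u * (ρ / m) + m / 28 := by
    field_simp; ring
  linarith

/-- The rate of convergence of the Newton scheme. -/
def newtonRate (n : ℕ) : ℝ := Real.exp (-((n : ℝ) ^ 2 + 3 * n) / 3)

lemma newtonRate_pos (n : ℕ) : 0 < newtonRate n := Real.exp_pos _

lemma four_mul_le (n : ℕ) : 4 * (n : ℝ) ≤ (n : ℝ) ^ 2 + 3 * n := by
  have : (n : ℝ) ≤ (n : ℝ) ^ 2 := by exact_mod_cast Nat.le_self_pow two_ne_zero n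
  linarith

lemma exp_neg_le_third_pow (n : ℕ) : Real.exp (-(8 / 7 * n)) ≤ (1 / 3 : ℝ) ^ n := by
  have h : Real.exp (-(8 / 7)) ≤ 1 / 3 := by
    rw [Real.exp_neg, inv_eq_one_div]
    gcongr
    have h1 := Real.exp_one_gt_d9
    have h2 := Real.add_one_le_exp (1 / 7 : ℝ)
    rw [show (8 / 7 : ℝ) = 1 + 1 / 7 by norm_num, Real.exp_add]
    nlinarith
  calc Real.exp (-(8 / 7 * n)) = Real.exp (-(8 / 7)) ^ n := by
        rw [← Real.exp_nat_mul]; congr 1; ring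
    _ ≤ _ := by gcongr

lemma newtonRate_le (n : ℕ) : newtonRate n ≤ (1 / 3 : ℝ) ^ n := by
  refine le_trans (Real.exp_le_exp.mpr ?_) (exp_neg_le_third_pow n)
  have := four_mul_le n
  have : (0 : ℝ) ≤ n := n.cast_nonneg
  linarith

/-- Makes the corrections F geometrically small despite the small divisors: since n² + 3n ≥ 4n, the
exponent is at most 1/14 - (25/21)n, and 25/21 > 8/7. -/
lemma exp_mul_newtonRate_le (n : ℕ) :
    Real.exp (((n : ℝ) + 1) * (n + 2) / 28) * newtonRate n ≤ 11 / 10 * (1 / 3 : ℝ) ^ n := by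
  have h1 : Real.exp (1 / 14) ≤ 11 / 10 := by
    have := Real.add_one_le_exp (-(1 / 14) : ℝ)
    rw [Real.exp_neg] at this
    have h := inv_anti₀ (by norm_num) this
    rw [inv_inv] at h
    refine h.trans (by norm_num)
  refine le_trans ?_ (mul_le_mul h1 (exp_neg_le_third_pow n) (Real.exp_pos _).le (by norm_num))
  rw [newtonRate, ← Real.exp_add, ← Real.exp_add, Real.exp_le_exp]
  have := four_mul_le n
  nlinarith

/-- Closes the quadratic recursion. A Gaussian rate suffices: squaring doubles n²/3, which pays both
for the small divisors, of order n²/28, and for the passage to n + 1. -/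
lemma exp_mul_newtonRate_sq_le (n : ℕ) :
    Real.exp (((n : ℝ) + 1) * (n + 2) / 28) * newtonRate n ^ 2 ≤ 8 * newtonRate (n + 1) := by
  have h1 : Real.exp 2 ≤ 8 := by
    have := Real.exp_one_lt_d9
    have := Real.exp_pos 1
    rw [show (2 : ℝ) = 1 + 1 by norm_num, Real.exp_add]
    nlinarith
  refine le_trans ?_ (mul_le_mul_of_nonneg_right h1 (newtonRate_pos _).le)
  rw [newtonRate, newtonRate, ← Real.exp_nat_mul, ← Real.exp_add, ← Real.exp_add, Real.exp_le_exp]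
  have := four_mul_le n
  push_cast
  nlinarith

/-! ### The Newton scheme -/

namespace Crossed

variable {G B : Type*} [AddCommGroup G] [NormedRing B] [NormedAlgebra ℂ B] [CompleteSpace B]
  {T : IsoAction G B}

/-- The state of the Newton scheme after `n` steps: `W (L + V - R) W⁻¹ = L + E`, where `L` is the
generator of the derivation `a_k ↦ lam k • a_k`, and `Z = W⁻¹`. -/
structure NewtonStage (lam : G →+ ℝ) (ℓ : G → ℝ) (ρ ε : ℝ) (V : Crossed T) (n : ℕ)
    (W Z : Crossed T) (R : B) (E : Crossed T) : Prop where
  mul_inv : W * Z = 1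
  inv_mul : Z * W = 1
  deriv : ∀ k, (W * (V - diag T R) - E * W) k = (lam k : ℂ) • W k
  error : Bd ℓ (ρ / (n + 1)) E (ε * newtonRate n)
  near : Bd ℓ (ρ / (n + 1)) (W - 1) (1 / 10 * (1 - (1 / 3) ^ n))
  near_inv : Bd ℓ (ρ / (n + 1)) (Z - 1) (1 / 10 * (1 - (1 / 3) ^ n))

-- The new error is quadratic because (1 + F)(L + E') = L (1 + F) + F E' whenever [L, F] = E'. The
-- counterterm is corrected in the original coordinates, so in the new ones the correction appears
-- as D = W r Z, which need not be diagonal.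
set_option maxHeartbeats 1000000 in
lemma NewtonStage.step [NormOneClass B] {lam : G →+ ℝ} {ℓ : G → ℝ} {ρ ε ς τ : ℝ}
    (hτ : 0 < τ) (hς : 0 < ς) (hρ : 0 < ρ) (hε : 0 ≤ ε)
    (hεV : ε ≤ ς / 64 * (Real.sqrt ρ / (2 * τ)) ^ (2 * τ))
    (hℓ0 : ℓ 0 = 0) (hℓpos : ∀ k, k ≠ 0 → 0 < ℓ k) (hℓ : ∀ k l, ℓ (k + l) ≤ ℓ k + ℓ l)
    (hdio : ∀ k, k ≠ 0 → ς / ℓ k ^ τ ≤ |lam k|)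
    {V : Crossed T} {n : ℕ} {W Z : Crossed T} {R : B} {E : Crossed T}
    (h : NewtonStage lam ℓ ρ ε V n W Z R E) :
    ∃ W' Z' R' E', NewtonStage lam ℓ ρ ε V (n + 1) W' Z' R' E' ∧
      ‖R' - R‖ ≤ 100 / 79 * ε * (1 / 3) ^ n ∧ ‖W' - W‖ ≤ (1 / 3) ^ n ∧
      ‖Z' - Z‖ ≤ (1 / 3) ^ n := by
  have hℓnn : ∀ k, 0 ≤ ℓ k := fun k => by
    by_cases hk : k = 0
    · rw [hk, hℓ0]
    · exact (hℓpos k hk).le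
  set σ := ρ / (n + 1) with hσd
  set σ' := ρ / ((n + 1 : ℕ) + 1) with hσd'
  have hσ : 0 < σ := by positivity
  have hσ' : 0 < σ' := by positivity
  have hσσ : σ' ≤ σ := by rw [hσd, hσd']; gcongr; linarith
  have hσsub : σ - σ' = ρ / (((n : ℝ) + 1) * (n + 2)) := by
    rw [hσd, hσd']; push_cast; field_simp; ring
  set q : ℝ := (1 / 3) ^ n with hq
  have hq0 : 0 < q := by positivity
  have hq1 : q ≤ 1 := pow_le_one₀ (by norm_num) (by norm_num)
  set w : ℝ := 1 / 10 * (1 - q) with hw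
  have hw0 : 0 ≤ w := by rw [hw]; linarith
  have hw1 : w ≤ 1 / 10 := by rw [hw]; linarith
  set θ := newtonRate n with hθ
  have hθ0 : 0 < θ := newtonRate_pos n
  set A := (Real.sqrt ρ / (2 * τ)) ^ (2 * τ) with hA
  have hA0 : 0 < A := by positivity
  set m : ℝ := ((n : ℝ) + 1) * (n + 2) with hm
  have hm0 : 0 < m := by positivity
  set g := Real.exp (m / 28) with hg
  have hg0 : 0 < g := Real.exp_pos _
  have hlam : ∀ k, k ≠ 0 → lam k ≠ 0 := fun k hk => by
    have h1 : 0 < ς / ℓ k ^ τ := div_pos hς (Real.rpow_pos_of_pos (hℓpos k hk) τ)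
    exact abs_pos.mp (h1.trans_le (hdio k hk))
  have hsd : ∀ k, k ≠ 0 → Real.exp (-(ℓ k * (σ - σ'))) ≤ g / (ς * A) * |lam k| := fun k hk => by
    have hu := hℓpos k hk
    have hr := Real.rpow_pos_of_pos hu τ
    have h1 := small_divisor_bound hτ hρ hu hm0
    rw [← hA, ← hg] at h1
    calc Real.exp (-(ℓ k * (σ - σ'))) ≤ g / (ς * A) * (ς / ℓ k ^ τ) := by
          rw [hσsub]
          have : g / (ς * A) * (ς / ℓ k ^ τ) = g / (ℓ k ^ τ * A) := by field_simp
          rw [this, le_div_iff₀ (by positivity), mul_comm]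
          exact h1
      _ ≤ _ := by gcongr; exact hdio k hk
  -- the correction of the counterterm
  have hWn := h.near.norm_le hℓnn hσ.le hw0
  have hZn := h.near_inv.norm_le hℓnn hσ.le hw0
  -- The value 21/100 is (11/10)² - 1, since W and Z stay within 1/10 of 1; hence the factor 100/79
  -- = 1/(1 - 21/100).
  obtain ⟨r, hr, hrn⟩ := exists_mean_eq (T := T) (c := 21 / 100) (w := w) (by nlinarith)
    (by norm_num) hw0 hWn hZn (E 0)
  have hEε : ‖E 0‖ ≤ ε * θ := h.error.norm_apply_le hℓnn hσ.le (by positivity) 0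
  have hrn' : ‖r‖ ≤ 100 / 79 * (ε * θ) := by
    refine hrn.trans ?_
    rw [div_le_iff₀ (by norm_num)]
    linarith
  set D := W * diag T r * Z with hD
  have bone : Bd ℓ σ (1 : Crossed T) 1 := by
    have := bd_diag (T := T) (σ := σ) hℓ0 (1 : B)
    rwa [norm_one] at this
  have bW : Bd ℓ σ W (11 / 10) := by
    have := (h.near.add hw0 zero_le_one bone).mono hℓnn le_rfl (C' := 11 / 10) (by linarith)
    rwa [sub_add_cancel] at this
  have bZ : Bd ℓ σ Z (11 / 10) := by
    have := (h.near_inv.add hw0 zero_le_one bone).mono hℓnn le_rfl (C' := 11 / 10) (by linarith)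
    rwa [sub_add_cancel] at this
  have bD : Bd ℓ σ D (8 / 5 * (ε * θ)) := by
    -- The constant is (11/10)² · 100/79 = 121/79 < 8/5.
    refine (((bW.mul hℓ hσ.le (by norm_num) (bd_diag hℓ0 r)).mul hℓ hσ.le (by positivity)
      bZ)).mono hℓnn le_rfl ?_
    nlinarith [mul_nonneg hε hθ0.le]
  set E' := E - D with hE'
  set e := 13 / 5 * (ε * θ) with he
  have he0 : 0 ≤ e := by positivity
  have bE' : Bd ℓ σ E' e := (h.error.sub (by positivity) (by positivity) bD).mono hℓnn le_rfl
    (by rw [he]; linarith)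
  have hE'0 : E' 0 = 0 := by rw [hE', sub_apply, hr, sub_self]
  -- the solution of the cohomological equation
  obtain ⟨F, hF, bF⟩ := exists_primitive (lam := lam) (K := g / (ς * A)) (by positivity) hlam hsd
    hℓnn hσ'.le bE' hE'0
  have hgθ := exp_mul_newtonRate_le n
  have hgθ2 := exp_mul_newtonRate_sq_le n
  rw [← hm, ← hg, ← hθ] at hgθ hgθ2
  -- The smallness hypothesis on V enters here.
  have hεA : ε / (ς * A) ≤ 1 / 64 := by
    rw [div_le_iff₀ (by positivity)]; linarith
  have hf1 : g / (ς * A) * e ≤ q / 20 := by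
    calc g / (ς * A) * e = 13 / 5 * (ε / (ς * A)) * (g * θ) := by rw [he]; ring
      _ ≤ 13 / 5 * (1 / 64) * (11 / 10 * q) := by gcongr
      _ ≤ q / 20 := by linarith
  have hf0 : 0 ≤ g / (ς * A) * e := by positivity
  have bF' : Bd ℓ σ' F (q / 20) := bF.mono hℓnn le_rfl hf1
  obtain ⟨Y, hY1, hY2, bY⟩ := exists_inverse hℓnn hℓ hσ'.le (by positivity) (by linarith) bF'
  have hdiv : q / 20 / (1 - q / 20) ≤ 1 / 19 * q := by
    rw [div_le_iff₀ (by linarith)]; nlinarith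
  have bY' : Bd ℓ σ' (Y - 1) (1 / 19 * q) := bY.mono hℓnn le_rfl hdiv
  have bone' : Bd ℓ σ' (1 : Crossed T) 1 := bone.mono hℓnn hσσ le_rfl
  have bYf : Bd ℓ σ' Y (20 / 19) := by
    have := (bY'.add (by positivity) zero_le_one bone').mono hℓnn le_rfl (C' := 20 / 19)
      (by linarith)
    rwa [sub_add_cancel] at this
  have bW' := bW.mono hℓnn hσσ le_rfl
  have bZ' := bZ.mono hℓnn hσσ le_rfl
  -- These two increments must fit into the growth (1/10)(q - q/3) = q/15 allowed to the bounds on W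
  -- - 1 and Z - 1.
  have bFW : Bd ℓ σ' (F * W) (11 / 200 * q) :=
    (bF'.mul hℓ hσ'.le (by positivity) bW').mono hℓnn le_rfl (by linarith)
  have bZY : Bd ℓ σ' (Z * (Y - 1)) (11 / 190 * q) :=
    (bZ'.mul hℓ hσ'.le (by positivity) bY').mono hℓnn le_rfl (by linarith)
  have hpow : (1 / 3 : ℝ) ^ (n + 1) = q / 3 := by rw [pow_succ, hq]; ring
  have eW : (1 + F) * W - W = F * W := by noncomm_ring
  have eZ : Z * Y - Z = Z * (Y - 1) := by noncomm_ring
  refine ⟨(1 + F) * W, Z * Y, R + r, F * E' * Y, ⟨?_, ?_, ?_, ?_, ?_, ?_⟩, ?_, ?_, ?_⟩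
  · calc (1 + F) * W * (Z * Y) = (1 + F) * (W * Z) * Y := by noncomm_ring
      _ = 1 := by rw [h.mul_inv, mul_one, hY1]
  · calc Z * Y * ((1 + F) * W) = Z * (Y * (1 + F)) * W := by noncomm_ring
      _ = 1 := by rw [hY2, mul_one, h.inv_mul]
  -- As the derivation kills 1, its value on 1 + F is E'. The Leibniz rule on (1 + F) W, with E = E'
  -- + D and D W = W r, gives the relation of the next stage.
  · have h1F : ∀ k, E' k = (lam k : ℂ) • (1 + F) k := fun k => by
      rw [add_apply, smul_add, ← hF]
      by_cases hk : k = 0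
      · simp [hk]
      · rw [one_def, diag_apply_ne _ hk, smul_zero, zero_add]
    have hl := leibniz lam h1F (fun k => h.deriv k)
    intro k
    rw [← hl k]
    congr 1
    have hDW : D * W = W * diag T r := by
      rw [hD, mul_assoc _ Z W, h.inv_mul, mul_one]
    have hE : E = E' + D := by rw [hE']; abel
    have h2 : F * E' * Y * ((1 + F) * W) = F * E' * W := by
      calc _ = F * E' * (Y * (1 + F)) * W := by noncomm_ring
        _ = _ := by rw [hY2, mul_one]
    have h3 : E * W = E' * W + W * diag T r := by rw [hE, add_mul, hDW]
    rw [h2, h3, diag_add]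
    noncomm_ring
  · refine ((bF.mul hℓ hσ'.le (by positivity) (bE'.mono hℓnn hσσ le_rfl)).mul hℓ hσ'.le
      (by positivity) bYf).mono hℓnn le_rfl ?_
    -- The factor 64 in the hypothesis is used here: (169/25)(20/19)(8/64) is less than 1.
    calc g / (ς * A) * e * e * (20 / 19)
        = 169 / 25 * (20 / 19) * (ε * (ε / (ς * A)) * (g * θ ^ 2)) := by rw [he]; ring
      _ ≤ 169 / 25 * (20 / 19) * (ε * (1 / 64) * (8 * newtonRate (n + 1))) := by gcongr
      _ ≤ ε * newtonRate (n + 1) := by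
        nlinarith [mul_nonneg hε (newtonRate_pos (n + 1)).le]
  · have := (bFW.add (by positivity) hw0 (h.near.mono hℓnn hσσ le_rfl)).mono hℓnn le_rfl
      (C' := 1 / 10 * (1 - (1 / 3) ^ (n + 1))) (by rw [hpow, hw]; linarith)
    convert this using 1
    rw [← eW]; abel
  · have := (bZY.add (by positivity) hw0 (h.near_inv.mono hℓnn hσσ le_rfl)).mono hℓnn le_rfl
      (C' := 1 / 10 * (1 - (1 / 3) ^ (n + 1))) (by rw [hpow, hw]; linarith)
    convert this using 1
    rw [← eZ]; abel
  · rw [add_sub_cancel_left]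
    refine hrn'.trans ?_
    have := mul_le_mul_of_nonneg_left (newtonRate_le n) hε
    rw [← hθ, ← hq] at this
    linarith
  · rw [eW]
    exact (bFW.norm_le hℓnn hσ'.le (by positivity)).trans (by linarith)
  · rw [eZ]
    exact (bZY.norm_le hℓnn hσ'.le (by positivity)).trans (by linarith)

/-- Existence of a counterterm `R` such that `L + V - R` is conjugate to `L`. -/
theorem exists_counterterm [NormOneClass B] {lam : G →+ ℝ} {ℓ : G → ℝ} {ρ ε ς τ : ℝ}
    (hτ : 0 < τ) (hς : 0 < ς) (hρ : 0 < ρ) (hε : 0 ≤ ε)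
    (hεV : ε ≤ ς / 64 * (Real.sqrt ρ / (2 * τ)) ^ (2 * τ))
    (hℓ0 : ℓ 0 = 0) (hℓpos : ∀ k, k ≠ 0 → 0 < ℓ k) (hℓ : ∀ k l, ℓ (k + l) ≤ ℓ k + ℓ l)
    (hdio : ∀ k, k ≠ 0 → ς / ℓ k ^ τ ≤ |lam k|)
    {V : Crossed T} (hV : Bd ℓ ρ V ε) :
    ∃ (W Z : Crossed T) (R : B), W * Z = 1 ∧ Z * W = 1 ∧ ‖W - 1‖ ≤ 1 / 10 ∧ ‖R‖ ≤ 2 * ε ∧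
      ∀ k, (W * (V - diag T R)) k = (lam k : ℂ) • W k := by
  have hℓnn : ∀ k, 0 ≤ ℓ k := fun k => by
    by_cases hk : k = 0
    · rw [hk, hℓ0]
    · exact (hℓpos k hk).le
  have h0 : NewtonStage lam ℓ ρ ε V 0 1 1 0 V := by
    have hz : Bd ℓ (ρ / ((0 : ℕ) + 1)) ((1 : Crossed T) - 1) (1 / 10 * (1 - (1 / 3) ^ 0)) := by
      have := bd_diag (T := T) (σ := ρ / ((0 : ℕ) + 1)) hℓ0 (0 : B)
      have hd : diag T (0 : B) = 0 := by simpa using diag_sub (T := T) (0 : B) 0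
      simpa [hd] using this
    refine ⟨one_mul 1, one_mul 1, fun k => ?_, ?_, hz, hz⟩
    · have hd : diag T (0 : B) = 0 := by simpa using diag_sub (T := T) (0 : B) 0
      rw [hd]
      simp only [sub_zero, one_mul, mul_one, sub_self, zero_apply]
      by_cases hk : k = 0
      · simp [hk]
      · rw [one_def, diag_apply_ne _ hk, smul_zero]
    · simpa [newtonRate] using hV
  let S : ℕ → Type _ := fun n => {p : Crossed T × Crossed T × B × Crossed T //
    NewtonStage lam ℓ ρ ε V n p.1 p.2.1 p.2.2.1 p.2.2.2}
  have hstep : ∀ n (p : S n), ∃ p' : S (n + 1),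
      ‖p'.1.2.2.1 - p.1.2.2.1‖ ≤ 100 / 79 * ε * (1 / 3) ^ n ∧ ‖p'.1.1 - p.1.1‖ ≤ (1 / 3) ^ n ∧
      ‖p'.1.2.1 - p.1.2.1‖ ≤ (1 / 3) ^ n := by
    rintro n ⟨⟨W, Z, R, E⟩, hp⟩
    obtain ⟨W', Z', R', E', h1, h2⟩ := hp.step hτ hς hρ hε hεV hℓ0 hℓpos hℓ hdio
    exact ⟨⟨⟨W', Z', R', E'⟩, h1⟩, h2⟩
  choose next hnext using hstep
  let x : ∀ n, S n := fun n => Nat.rec ⟨⟨1, 1, 0, V⟩, h0⟩ next n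
  have hx : ∀ n, x (n + 1) = next n (x n) := fun n => rfl
  have hx0 : (x 0).1.2.2.1 = 0 := rfl
  have hst : ∀ n, NewtonStage lam ℓ ρ ε V n (x n).1.1 (x n).1.2.1 (x n).1.2.2.1 (x n).1.2.2.2 :=
    fun n => (x n).2
  have hdR : ∀ n, ‖(x (n + 1)).1.2.2.1 - (x n).1.2.2.1‖ ≤ 100 / 79 * ε * (1 / 3) ^ n :=
    fun n => by rw [hx]; exact (hnext n (x n)).1
  have hdW : ∀ n, ‖(x (n + 1)).1.1 - (x n).1.1‖ ≤ (1 / 3) ^ n :=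
    fun n => by rw [hx]; exact (hnext n (x n)).2.1
  have hdZ : ∀ n, ‖(x (n + 1)).1.2.1 - (x n).1.2.1‖ ≤ (1 / 3) ^ n :=
    fun n => by rw [hx]; exact (hnext n (x n)).2.2
  generalize x = x at hx0 hst hdR hdW hdZ
  -- The radii ρ/(n+1) shrink to 0, so the limits are taken in the unweighted ℓ¹ norm. The
  -- counterterm has lost nothing: it lives in B, whose norm is the same at every stage.
  obtain ⟨W, hW⟩ := cauchySeq_tendsto_of_complete (cauchySeq_of_le_geometric (1 / 3) 1
    (by norm_num) (f := fun n => (x n).1.1) fun n => by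
      rw [dist_comm, dist_eq_norm, one_mul]; exact hdW n)
  obtain ⟨Z, hZ⟩ := cauchySeq_tendsto_of_complete (cauchySeq_of_le_geometric (1 / 3) 1
    (by norm_num) (f := fun n => (x n).1.2.1) fun n => by
      rw [dist_comm, dist_eq_norm, one_mul]; exact hdZ n)
  have hR' : ∀ n, dist (x n).1.2.2.1 (x (n + 1)).1.2.2.1 ≤ 100 / 79 * ε * (1 / 3) ^ n := fun n => by
    rw [dist_comm, dist_eq_norm]; exact hdR n
  obtain ⟨R, hR⟩ := cauchySeq_tendsto_of_complete (cauchySeq_of_le_geometric (1 / 3) _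
    (by norm_num) hR')
  have hE : Filter.Tendsto (fun n => (x n).1.2.2.2) Filter.atTop (nhds 0) := by
    refine squeeze_zero_norm (a := fun n => ε * (1 / 3) ^ n) (fun n => ?_) ?_
    · exact ((hst n).error.norm_le hℓnn (by positivity)
        (mul_nonneg hε (newtonRate_pos n).le)).trans (by gcongr; exact newtonRate_le n)
    · simpa using (tendsto_pow_atTop_nhds_zero_of_lt_one (r := (1 / 3 : ℝ)) (by norm_num)
        (by norm_num)).const_mul ε
  refine ⟨W, Z, R, ?_, ?_, ?_, ?_, ?_⟩
  · refine tendsto_nhds_unique (hW.mul hZ) ?_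
    simp only [(hst _).mul_inv]
    exact tendsto_const_nhds
  · refine tendsto_nhds_unique (hZ.mul hW) ?_
    simp only [(hst _).inv_mul]
    exact tendsto_const_nhds
  · refine le_of_tendsto (hW.sub_const 1).norm (Filter.Eventually.of_forall fun n => ?_)
    have hp : (0 : ℝ) < (1 / 3) ^ n := by positivity
    have hp1 : (1 / 3 : ℝ) ^ n ≤ 1 := pow_le_one₀ (by norm_num) (by norm_num)
    exact ((hst n).near.norm_le hℓnn (by positivity) (by linarith)).trans (by linarith)
  · have := dist_le_of_le_geometric_of_tendsto₀ (1 / 3) _ (by norm_num) hR' hR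
    rw [hx0, dist_comm, dist_zero_right] at this
    refine this.trans ?_
    -- Sum of the geometric series of corrections, starting from R = 0; 150/79 is below 2.
    have : 100 / 79 * ε / (1 - 1 / 3) = 150 / 79 * ε := by ring
    linarith
  · intro k
    have hdiag : Continuous (diag T : B → Crossed T) := by
      refine continuous_iff_continuousAt.mpr fun b => ?_
      refine tendsto_iff_norm_sub_tendsto_zero.mpr ?_
      simp_rw [← diag_sub, norm_diag]
      exact tendsto_iff_norm_sub_tendsto_zero.mp Filter.tendsto_id
    have hev : Continuous (fun a : Crossed T => a k) :=
      (lp.evalCLM ℂ (fun _ : G => B) 1 k).continuous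
    have h1 := ((hW.mul ((hdiag.tendsto R |>.comp hR).const_sub V)).sub (hE.mul hW))
    rw [zero_mul, sub_zero] at h1
    have h2 := (hev.tendsto _).comp h1
    refine tendsto_nhds_unique h2 ?_
    refine (((hev.tendsto _).comp hW).const_smul (lam k : ℂ)).congr fun n => ?_
    exact ((hst n).deriv k).symm

end Crossed

end

noncomputable section

/-! ### The algebra `𝒜_s(ℝ^d)` through Fourier transforms -/

open scoped FourierTransform Convolution in
/-- The integral in `HasFourierTransform` in terms of Mathlib's Fourier transform. -/
lemma integral_mul_exp_eq_fourier {d : ℕ} (g : Space d → ℂ) (ξ : Space d) :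
    ∫ η, g η * Complex.exp (Complex.I * (⟪η, ξ⟫_ℝ : ℝ)) = 𝓕 g (-(2 * Real.pi)⁻¹ • ξ) := by
  rw [Real.fourier_eq']
  refine integral_congr_ae (Filter.Eventually.of_forall fun η => ?_)
  simp only [smul_eq_mul]
  rw [mul_comm, inner_smul_right]
  congr 2
  have := Real.pi_ne_zero
  push_cast
  have h : (Real.pi : ℂ) ≠ 0 := by exact_mod_cast this
  field_simp

lemma integrable_mul_exp {d : ℕ} {g : Space d → ℂ} (hg : Integrable g) (ξ : Space d) :
    Integrable fun η => g η * Complex.exp (Complex.I * (⟪η, ξ⟫_ℝ : ℝ)) := by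
  refine hg.mul_bdd (c := 1) (by fun_prop) (Filter.Eventually.of_forall fun η => ?_)
  rw [mul_comm, Complex.norm_exp_ofReal_mul_I]

open scoped FourierTransform SchwartzMap in
/-- An integrable function with vanishing Fourier transform vanishes almost everywhere. -/
lemma ae_eq_zero_of_integral_mul_exp_eq_zero {d : ℕ} {g : Space d → ℂ} (hg : Integrable g)
    (h : ∀ ξ, ∫ η, g η * Complex.exp (Complex.I * (⟪η, ξ⟫_ℝ : ℝ)) = 0) : g =ᵐ[volume] 0 := by
  have hF : 𝓕 g = 0 := by
    ext ξ
    have := h (-(2 * Real.pi) • ξ)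
    have h1 : -(2 * Real.pi)⁻¹ * -(2 * Real.pi) = 1 := by
      have := Real.pi_ne_zero
      field_simp
    rwa [integral_mul_exp_eq_fourier, smul_smul, h1, one_smul] at this
  refine ae_eq_zero_of_integral_contDiff_smul_eq_zero hg.locallyIntegrable fun φ hφ hφc => ?_
  have hφc' : HasCompactSupport (fun x => (φ x : ℂ)) := hφc.comp_left (g := Complex.ofReal) Complex.ofReal_zero
  have hφ' : ContDiff ℝ ((⊤ : ℕ∞) : WithTop ℕ∞) (fun x => (φ x : ℂ)) := Complex.ofRealCLM.contDiff.comp hφ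
  obtain ⟨Φ, hΦ⟩ : ∃ Φ : 𝓢(Space d, ℂ), ∀ x, Φ x = (φ x : ℂ) :=
    ⟨hφc'.toSchwartzMap hφ', fun x => rfl⟩
  -- Every test function is the Fourier transform of a Schwartz function, so the integral of g
  -- against it equals that of 𝓕 g = 0 against ψ.
  obtain ⟨ψ, hψ⟩ : ∃ ψ : 𝓢(Space d, ℂ), 𝓕 ψ = Φ := ⟨𝓕⁻ Φ, FourierTransform.fourier_fourierInv_eq Φ⟩
  have h1 : ∫ ξ, 𝓕 g ξ • ψ ξ = ∫ x, g x • 𝓕 (ψ : Space d → ℂ) x := by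
    simpa using! VectorFourier.integral_fourierIntegral_smul_eq_flip (L := innerₗ (Space d))
      Real.continuous_fourierChar continuous_inner hg ψ.integrable
  have h2 : 𝓕 (ψ : Space d → ℂ) = Φ := by rw [← SchwartzMap.fourier_coe, hψ]
  rw [hF, h2] at h1
  simp only [Pi.zero_apply, zero_smul, integral_zero] at h1
  rw [h1]
  refine integral_congr_ae (Filter.Eventually.of_forall fun x => ?_)
  simp only [hΦ, smul_eq_mul, Complex.real_smul]
  rw [mul_comm]

lemma fourierConst_pos (d : ℕ) : 0 < fourierConst d := Real.rpow_pos_of_pos Real.two_pi_pos _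

/-- The functions `ξ ↦ (2π)^{-d/2} ∫ g(η) e^{i η·ξ} dη` with `∫ |g(η)| e^{s|η|} dη < ∞`, encoded by
`(2π)^{-d/2} e^{s|η|} g(η) ∈ L¹`. -/
def FourierAlg (d : ℕ) (_s : ℝ) : Type := Lp ℂ 1 (volume : Measure (Space d))

namespace FourierAlg

variable {d : ℕ} {s : ℝ}

instance : NormedAddCommGroup (FourierAlg d s) :=
  inferInstanceAs (NormedAddCommGroup (Lp ℂ 1 (volume : Measure (Space d))))

instance : NormedSpace ℂ (FourierAlg d s) :=
  inferInstanceAs (NormedSpace ℂ (Lp ℂ 1 (volume : Measure (Space d))))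

instance : CompleteSpace (FourierAlg d s) :=
  inferInstanceAs (CompleteSpace (Lp ℂ 1 (volume : Measure (Space d))))

/-- The weight `(2π)^{-d/2} e^{s|η|}`. -/
def weight (d : ℕ) (s : ℝ) (η : Space d) : ℝ := fourierConst d * Real.exp (‖η‖ * s)

lemma weight_pos (η : Space d) : 0 < weight d s η := mul_pos (fourierConst_pos d) (Real.exp_pos _)

lemma continuous_weight : Continuous (weight d s) := by unfold weight; fun_prop

/-- The weighted Fourier transform, as an element of `L¹`. -/
def toL1 (u : FourierAlg d s) : Lp ℂ 1 (volume : Measure (Space d)) := u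

/-- The Fourier transform. -/
def dens (u : FourierAlg d s) (η : Space d) : ℂ := ((weight d s η)⁻¹ : ℝ) * u.toL1 η

/-- The function itself. -/
def ev (u : FourierAlg d s) (ξ : Space d) : ℂ :=
  (fourierConst d : ℂ) * ∫ η, u.dens η * Complex.exp (Complex.I * (⟪η, ξ⟫_ℝ : ℝ))

lemma norm_eq (u : FourierAlg d s) : ‖u‖ = ∫ η, ‖u.toL1 η‖ := L1.norm_eq_integral_norm u.toL1

lemma weight_mul_dens (u : FourierAlg d s) (η : Space d) :
    (weight d s η : ℂ) * u.dens η = u.toL1 η := by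
  have : (weight d s η : ℂ) ≠ 0 := by exact_mod_cast (weight_pos η).ne'
  rw [dens, Complex.ofReal_inv, mul_inv_cancel_left₀ this]

lemma norm_toL1 (u : FourierAlg d s) (η : Space d) :
    ‖u.toL1 η‖ = weight d s η * ‖u.dens η‖ := by
  rw [← weight_mul_dens, norm_mul, Complex.norm_real, Real.norm_of_nonneg (weight_pos η).le]

lemma integrable_toL1 (u : FourierAlg d s) : Integrable u.toL1 := L1.integrable_coeFn u.toL1

/-- The element with a given Fourier transform. -/
def mk (g : Space d → ℂ) (hg : Integrable fun η => (weight d s η : ℂ) * g η) : FourierAlg d s :=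
  hg.toL1 _

lemma toL1_mk {g : Space d → ℂ} (hg : Integrable fun η => (weight d s η : ℂ) * g η) :
    (mk g hg).toL1 =ᵐ[volume] fun η => (weight d s η : ℂ) * g η := hg.coeFn_toL1

lemma dens_mk {g : Space d → ℂ} (hg : Integrable fun η => (weight d s η : ℂ) * g η) :
    (mk g hg).dens =ᵐ[volume] g := by
  filter_upwards [toL1_mk hg] with η hη
  have : (weight d s η : ℂ) ≠ 0 := by exact_mod_cast (weight_pos η).ne'
  rw [dens, hη, Complex.ofReal_inv, inv_mul_cancel_left₀ this]

lemma ev_mk {g : Space d → ℂ} (hg : Integrable fun η => (weight d s η : ℂ) * g η) (ξ : Space d) :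
    (mk g hg).ev ξ =
      (fourierConst d : ℂ) * ∫ η, g η * Complex.exp (Complex.I * (⟪η, ξ⟫_ℝ : ℝ)) := by
  rw [ev]
  congr 1
  refine integral_congr_ae ?_
  filter_upwards [dens_mk hg] with η hη
  rw [hη]

lemma norm_mk {g : Space d → ℂ} (hg : Integrable fun η => (weight d s η : ℂ) * g η) :
    ‖mk g hg‖ = ∫ η, weight d s η * ‖g η‖ := by
  rw [norm_eq]
  refine integral_congr_ae ?_
  filter_upwards [toL1_mk hg] with η hη
  rw [hη, norm_mul, Complex.norm_real, Real.norm_of_nonneg (weight_pos η).le]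

lemma norm_eq_dens (u : FourierAlg d s) : ‖u‖ = ∫ η, weight d s η * ‖u.dens η‖ := by
  simp_rw [norm_eq, norm_toL1]

variable [hs : Fact (0 < s)]

lemma const_le_weight (η : Space d) : fourierConst d ≤ weight d s η :=
  le_mul_of_one_le_right (fourierConst_pos d).le
    (Real.one_le_exp (mul_nonneg (norm_nonneg _) hs.out.le))

lemma integrable_of_weight {g : Space d → ℂ}
    (hg : Integrable fun η => (weight d s η : ℂ) * g η) : Integrable g := by
  have h1 : Continuous fun η : Space d => (((weight d s η)⁻¹ : ℝ) : ℂ) :=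
    Complex.continuous_ofReal.comp (continuous_weight.inv₀ fun η => (weight_pos η).ne')
  refine (hg.bdd_mul (c := (fourierConst d)⁻¹) h1.aestronglyMeasurable
    (Filter.Eventually.of_forall fun η => ?_)).congr (Filter.Eventually.of_forall fun η => ?_)
  · rw [Complex.norm_real, Real.norm_of_nonneg (inv_nonneg.mpr (weight_pos η).le)]
    exact inv_anti₀ (fourierConst_pos d) (const_le_weight η)
  · have : (weight d s η : ℂ) ≠ 0 := by exact_mod_cast (weight_pos η).ne'
    simp only [Complex.ofReal_inv]
    rw [inv_mul_cancel_left₀ this]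

lemma integrable_dens (u : FourierAlg d s) : Integrable u.dens :=
  integrable_of_weight (s := s) (by simp_rw [weight_mul_dens]; exact u.integrable_toL1)

lemma hasFourierTransform_ev (u : FourierAlg d s) : HasFourierTransform u.ev u.dens :=
  ⟨u.integrable_dens, fun _ => rfl⟩

lemma ev_add (u v : FourierAlg d s) (ξ : Space d) : (u + v).ev ξ = u.ev ξ + v.ev ξ := by
  rw [ev, ev, ev, ← mul_add, ← integral_add (integrable_mul_exp u.integrable_dens ξ)
    (integrable_mul_exp v.integrable_dens ξ)]
  congr 1
  refine integral_congr_ae ?_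
  filter_upwards [Lp.coeFn_add u.toL1 v.toL1] with η hη
  have : (u + v).toL1 η = u.toL1 η + v.toL1 η := hη
  simp only [dens, this]
  ring

lemma ev_smul (c : ℂ) (u : FourierAlg d s) (ξ : Space d) : (c • u).ev ξ = c * u.ev ξ := by
  rw [ev, ev, mul_left_comm, ← integral_const_mul c]
  congr 1
  refine integral_congr_ae ?_
  filter_upwards [Lp.coeFn_smul c u.toL1] with η hη
  have : (c • u).toL1 η = c * u.toL1 η := hη
  simp only [dens, this]
  ring

lemma norm_ev_le (u : FourierAlg d s) (ξ : Space d) : ‖u.ev ξ‖ ≤ ‖u‖ := by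
  rw [ev, norm_mul, Complex.norm_real, Real.norm_of_nonneg (fourierConst_pos d).le, norm_eq_dens,
    ← le_div_iff₀' (fourierConst_pos d)]
  refine (norm_integral_le_integral_norm _).trans ?_
  rw [← integral_div]
  refine integral_mono (integrable_mul_exp u.integrable_dens ξ).norm ?_ fun η => ?_
  · simp_rw [← norm_toL1]; exact u.integrable_toL1.norm.div_const _
  · simp only [norm_mul]
    rw [mul_comm Complex.I, Complex.norm_exp_ofReal_mul_I, mul_one,
      le_div_iff₀' (fourierConst_pos d)]
    gcongr
    exact const_le_weight η

lemma dens_ae_unique {f g g' : Space d → ℂ} (h : HasFourierTransform f g)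
    (h' : HasFourierTransform f g') : g =ᵐ[volume] g' := by
  have hc : (fourierConst d : ℂ) ≠ 0 := by exact_mod_cast (fourierConst_pos d).ne'
  have := ae_eq_zero_of_integral_mul_exp_eq_zero (h.1.sub h'.1) fun ξ => by
    simp_rw [Pi.sub_apply, sub_mul]
    rw [integral_sub (integrable_mul_exp h.1 ξ) (integrable_mul_exp h'.1 ξ), sub_eq_zero]
    exact mul_left_cancel₀ hc ((h.2 ξ).symm.trans (h'.2 ξ))
  filter_upwards [this] with η hη
  exact sub_eq_zero.mp hη

lemma ev_injective : Function.Injective (ev : FourierAlg d s → Space d → ℂ) := by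
  intro u v h
  have hu := u.hasFourierTransform_ev
  rw [h] at hu
  refine Lp.ext (f := u.toL1) (g := v.toL1) ?_
  filter_upwards [dens_ae_unique hu v.hasFourierTransform_ev] with η hη
  rw [← weight_mul_dens, hη, weight_mul_dens]

lemma enorm_eq (u : FourierAlg d s) : ‖u‖ₑ = ENNReal.ofReal (fourierConst d) *
    ∫⁻ η, ‖u.dens η‖ₑ * ENNReal.ofReal (Real.exp (‖η‖ * s)) := by
  have : ‖u‖ₑ = ∫⁻ η, ‖u.toL1 η‖ₑ := by
    rw [← ofReal_norm, norm_eq, ofReal_integral_norm_eq_lintegral_enorm u.integrable_toL1]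
  rw [this, ← lintegral_const_mul' _ _ ENNReal.ofReal_ne_top]
  refine lintegral_congr fun η => ?_
  rw [← ofReal_norm, norm_toL1, ENNReal.ofReal_mul (weight_pos η).le, weight,
    ENNReal.ofReal_mul (fourierConst_pos d).le, ofReal_norm]
  ring

/-- By uniqueness of the transform almost everywhere, the infimum runs over a single value. -/
lemma spaceNorm_ev (u : FourierAlg d s) : spaceNorm s u.ev = ‖u‖ₑ := by
  rw [enorm_eq]
  refine le_antisymm (iInf₂_le _ u.hasFourierTransform_ev) (le_iInf₂ fun g hg => le_of_eq ?_)
  congr 1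
  refine lintegral_congr_ae ?_
  filter_upwards [dens_ae_unique hg u.hasFourierTransform_ev] with η hη
  rw [hη]

lemma exists_ev_eq {f : Space d → ℂ} (hf : spaceNorm s f < ∞) : ∃ u : FourierAlg d s, u.ev = f := by
  simp only [spaceNorm, iInf_lt_iff] at hf
  obtain ⟨g, hg, hlt⟩ := hf
  have hi : Integrable fun η => (weight d s η : ℂ) * g η := by
    refine ⟨(Complex.continuous_ofReal.comp continuous_weight).aestronglyMeasurable.mul
      hg.1.aestronglyMeasurable, ?_⟩
    refine lt_of_le_of_lt (le_of_eq ?_) hlt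
    rw [← lintegral_const_mul' _ _ ENNReal.ofReal_ne_top]
    refine lintegral_congr fun η => ?_
    rw [enorm_mul, ← ofReal_norm, Complex.norm_real, Real.norm_of_nonneg (weight_pos η).le, weight,
      ENNReal.ofReal_mul (fourierConst_pos d).le]
    ring
  refine ⟨mk g hi, funext fun ξ => ?_⟩
  rw [ev_mk, hg.2 ξ]

open scoped Convolution in
-- The transform of a product is (2π)^{-d/2} times the convolution of the transforms. That factor
-- together with |η| ≤ |t| + |η - t| makes the weight submultiplicative, so the weighted transform
-- is dominated by a convolution of L¹ functions.
lemma exists_mul (u v : FourierAlg d s) :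
    ∃ w : FourierAlg d s, (∀ ξ, w.ev ξ = u.ev ξ * v.ev ξ) ∧ ‖w‖ ≤ ‖u‖ * ‖v‖ := by
  let L := ContinuousLinearMap.mul ℝ ℝ
  let M := ContinuousLinearMap.mul ℂ ℂ
  have hP : Integrable ((fun η => ‖u.toL1 η‖) ⋆[L, volume] fun η => ‖v.toL1 η‖) :=
    u.integrable_toL1.norm.integrable_convolution L v.integrable_toL1.norm
  have hQ : Integrable (u.dens ⋆[M, volume] v.dens) :=
    u.integrable_dens.integrable_convolution M v.integrable_dens
  let g : Space d → ℂ := fun η => (fourierConst d : ℂ) * (u.dens ⋆[M, volume] v.dens) η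
  have hle : ∀ᵐ η : Space d, weight d s η * ‖g η‖ ≤
      ((fun η => ‖u.toL1 η‖) ⋆[L, volume] fun η => ‖v.toL1 η‖) η := by
    filter_upwards [u.integrable_toL1.norm.ae_convolution_exists L v.integrable_toL1.norm]
      with η hη
    simp only [g, norm_mul, Complex.norm_real, Real.norm_of_nonneg (fourierConst_pos d).le]
    rw [convolution_def, convolution_def, ← mul_assoc]
    calc _ ≤ weight d s η * fourierConst d * ∫ t, ‖M (u.dens t) (v.dens (η - t))‖ := by
          gcongr
          · exact mul_nonneg (weight_pos η).le (fourierConst_pos d).le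
          · exact norm_integral_le_integral_norm _
      _ = ∫ t, weight d s η * fourierConst d * ‖M (u.dens t) (v.dens (η - t))‖ :=
          (integral_const_mul _ _).symm
      _ ≤ _ := by
          refine integral_mono_of_nonneg (Filter.Eventually.of_forall fun t => ?_) hη
            (Filter.Eventually.of_forall fun t => ?_)
          · have := (weight_pos (s := s) η).le
            have := (fourierConst_pos d).le
            positivity
          · simp only [M, L, ContinuousLinearMap.mul_apply', norm_mul, norm_toL1]
            have : weight d s η * fourierConst d ≤ weight d s t * weight d s (η - t) := by
              unfold weight
              have h1 : Real.exp (‖η‖ * s) ≤ Real.exp (‖t‖ * s) * Real.exp (‖η - t‖ * s) := by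
                rw [← Real.exp_add, ← add_mul, Real.exp_le_exp]
                refine mul_le_mul_of_nonneg_right ?_ hs.out.le
                simpa using norm_add_le t (η - t)
              have := fourierConst_pos d
              calc _ = fourierConst d * fourierConst d * Real.exp (‖η‖ * s) := by ring
                _ ≤ fourierConst d * fourierConst d *
                    (Real.exp (‖t‖ * s) * Real.exp (‖η - t‖ * s)) := by gcongr
                _ = _ := by ring
            calc _ ≤ weight d s t * weight d s (η - t) * (‖u.dens t‖ * ‖v.dens (η - t)‖) := by
                  gcongr
              _ = _ := by ring
  have hg : Integrable fun η => (weight d s η : ℂ) * g η := by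
    refine hP.mono' ?_ ?_
    · exact (Complex.continuous_ofReal.comp continuous_weight).aestronglyMeasurable.mul
        (hQ.const_mul _).aestronglyMeasurable
    · filter_upwards [hle] with η hη
      rwa [norm_mul, Complex.norm_real, Real.norm_of_nonneg (weight_pos η).le]
  refine ⟨mk g hg, fun ξ => ?_, ?_⟩
  · rw [ev_mk, ev, ev]
    simp only [integral_mul_exp_eq_fourier]
    have h1 : FourierTransform.fourier g =
        FourierTransform.fourier ((fourierConst d : ℂ) • (u.dens ⋆[M, volume] v.dens)) := rfl
    have h2 := Real.fourier_mul_convolution_eq u.integrable_dens v.integrable_dens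
      (-(2 * Real.pi)⁻¹ • ξ)
    have h3 : FourierTransform.fourier g (-(2 * Real.pi)⁻¹ • ξ) = (fourierConst d : ℂ) *
        FourierTransform.fourier (u.dens ⋆[M, volume] v.dens) (-(2 * Real.pi)⁻¹ • ξ) := by
      rw [← integral_mul_exp_eq_fourier, ← integral_mul_exp_eq_fourier, ← integral_const_mul]
      simp only [g, mul_assoc]
    rw [h3, h2]
    ring
  · rw [norm_mk, norm_eq u, norm_eq v]
    have h1 := integral_convolution L (μ := volume) (ν := volume) u.integrable_toL1.norm
      v.integrable_toL1.norm
    calc _ ≤ ∫ η, ((fun η => ‖u.toL1 η‖) ⋆[L, volume] fun η => ‖v.toL1 η‖) η :=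
          integral_mono_of_nonneg (Filter.Eventually.of_forall fun η =>
            mul_nonneg (weight_pos η).le (norm_nonneg _)) hP hle
      _ = _ := h1

lemma exists_translate (a : Space d) (u : FourierAlg d s) :
    ∃ w : FourierAlg d s, (∀ ξ, w.ev ξ = u.ev (ξ - a)) ∧ ‖w‖ = ‖u‖ := by
  have hg : Integrable fun η => (weight d s η : ℂ) *
      (u.dens η * Complex.exp (Complex.I * (⟪η, -a⟫_ℝ : ℝ))) := by
    simp_rw [← mul_assoc, weight_mul_dens]
    exact integrable_mul_exp u.integrable_toL1 _
  refine ⟨mk _ hg, fun ξ => ?_, ?_⟩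
  · rw [ev_mk, ev]
    congr 2
    ext η
    rw [mul_assoc, ← Complex.exp_add, ← mul_add, sub_eq_add_neg, inner_add_right]
    push_cast
    rw [add_comm (⟪η, -a⟫_ℝ : ℂ)]
  · rw [norm_mk, norm_eq_dens]
    congr 1
    ext η
    rw [norm_mul, mul_comm Complex.I, Complex.norm_exp_ofReal_mul_I, mul_one]

/-- Conjugating f sends its transform to the conjugate of η ↦ f̂(-η), and the weight is even. It
serves to keep real parts in the algebra without increasing the norm. -/
lemma exists_conj (u : FourierAlg d s) :
    ∃ w : FourierAlg d s, (∀ ξ, w.ev ξ = starRingEnd ℂ (u.ev ξ)) ∧ ‖w‖ = ‖u‖ := by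
  have hneg := u.integrable_toL1.comp_neg
  have hw : ∀ η : Space d, weight d s (-η) = weight d s η := fun η => by simp [weight]
  have hg : Integrable fun η => (weight d s η : ℂ) * starRingEnd ℂ (u.dens (-η)) := by
    refine (Complex.conjLIE.toContinuousLinearEquiv.toContinuousLinearMap.integrable_comp
      hneg).congr (Filter.Eventually.of_forall fun η => ?_)
    simp [← weight_mul_dens, hw]
  refine ⟨mk _ hg, fun ξ => ?_, ?_⟩
  · rw [ev_mk, ev, map_mul, Complex.conj_ofReal, ← integral_conj]
    congr 1
    rw [← integral_neg_eq_self]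
    refine integral_congr_ae (Filter.Eventually.of_forall fun η => ?_)
    simp only [neg_neg, map_mul, inner_neg_left, ← Complex.exp_conj, Complex.conj_I,
      Complex.conj_ofReal]
    push_cast
    ring_nf
  · rw [norm_mk, norm_eq_dens, ← integral_neg_eq_self]
    refine integral_congr_ae (Filter.Eventually.of_forall fun η => ?_)
    simp [hw]

instance : Mul (FourierAlg d s) where
  mul u v := (exists_mul u v).choose

lemma ev_mul (u v : FourierAlg d s) (ξ : Space d) : (u * v).ev ξ = u.ev ξ * v.ev ξ :=
  (exists_mul u v).choose_spec.1 ξ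

lemma norm_mul_le' (u v : FourierAlg d s) : ‖u * v‖ ≤ ‖u‖ * ‖v‖ := (exists_mul u v).choose_spec.2

lemma ev_zero (ξ : Space d) : (0 : FourierAlg d s).ev ξ = 0 := by
  have := ev_smul (0 : ℂ) (0 : FourierAlg d s) ξ
  rwa [zero_smul, zero_mul] at this

lemma ev_ext {u v : FourierAlg d s} (h : ∀ ξ, u.ev ξ = v.ev ξ) : u = v := ev_injective (funext h)

/-- The ring identities hold for values at each ξ and descend through `ev_injective`, so no identity
for convolutions has to be checked. -/
instance : NonUnitalNormedRing (FourierAlg d s) where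
  __ := (inferInstance : NormedAddCommGroup (FourierAlg d s))
  mul_assoc u v w := ev_ext fun ξ => by simp only [ev_mul, mul_assoc]
  zero_mul u := ev_ext fun ξ => by simp only [ev_mul, ev_zero, zero_mul]
  mul_zero u := ev_ext fun ξ => by simp only [ev_mul, ev_zero, mul_zero]
  left_distrib u v w := ev_ext fun ξ => by simp only [ev_mul, ev_add, mul_add]
  right_distrib u v w := ev_ext fun ξ => by simp only [ev_mul, ev_add, add_mul]
  norm_mul_le := norm_mul_le'

instance : IsScalarTower ℂ (FourierAlg d s) (FourierAlg d s) where
  smul_assoc c u v := ev_ext fun ξ => by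
    simp only [smul_eq_mul, ev_mul, ev_smul, mul_assoc]

instance : SMulCommClass ℂ (FourierAlg d s) (FourierAlg d s) where
  smul_comm c u v := ev_ext fun ξ => by
    simp only [smul_eq_mul, ev_mul, ev_smul, mul_left_comm]

/-- Translation `f ↦ f(· - a)`. -/
def translate (a : Space d) (u : FourierAlg d s) : FourierAlg d s := (exists_translate a u).choose

lemma ev_translate (a : Space d) (u : FourierAlg d s) (ξ : Space d) :
    (translate a u).ev ξ = u.ev (ξ - a) := (exists_translate a u).choose_spec.1 ξ

lemma norm_translate (a : Space d) (u : FourierAlg d s) : ‖translate a u‖ = ‖u‖ :=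
  (exists_translate a u).choose_spec.2

/-- Translation as an endomorphism of algebras. -/
def translateHom (a : Space d) : FourierAlg d s →ₙₐ[ℂ] FourierAlg d s where
  toFun := translate a
  map_smul' c u := ev_ext fun ξ => by simp only [ev_translate, ev_smul, MonoidHom.id_apply]
  map_zero' := ev_ext fun ξ => by simp only [ev_translate, ev_zero]
  map_add' u v := ev_ext fun ξ => by simp only [ev_translate, ev_add]
  map_mul' u v := ev_ext fun ξ => by simp only [ev_translate, ev_mul]

end FourierAlg

end

noncomputable section

/-! ### The lattice -/

section Lattice

variable {d : ℕ}

lemma latticeVec_add (k l : Fin d → ℤ) : latticeVec (k + l) = latticeVec k + latticeVec l := by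
  ext i; simp [latticeVec]

lemma latticeVec_zero : latticeVec (0 : Fin d → ℤ) = 0 := by
  ext i; simp [latticeVec]

lemma latticeVec_sub (k l : Fin d → ℤ) : latticeVec (k - l) = latticeVec k - latticeVec l := by
  ext i; simp [latticeVec]

lemma latticeVec_ne_zero {k : Fin d → ℤ} (hk : k ≠ 0) : latticeVec k ≠ 0 := by
  intro h
  refine hk (funext fun i => ?_)
  have := congrArg (fun x : Space d => x i) h
  simpa [latticeVec] using this

/-- The frequency `ω·k` as a homomorphism. -/
def frequency (ω : Space d) : (Fin d → ℤ) →+ ℝ where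
  toFun k := ⟪ω, latticeVec k⟫_ℝ
  map_zero' := by rw [latticeVec_zero, inner_zero_right]
  map_add' k l := by rw [latticeVec_add, inner_add_right]

end Lattice

/-! ### Adjoining the constants to `𝒜_s(ℝ^d)` -/

/-- The algebra `ℂ ⊕ 𝒜_s(ℝ^d)`. -/
abbrev UnitalAlg (d : ℕ) (s : ℝ) [Fact (0 < s)] : Type :=
  WithLp 1 (Unitization ℂ (FourierAlg d s))

namespace UnitalAlg

open WithLp Unitization

variable {d : ℕ} {s : ℝ} [hs : Fact (0 < s)]

instance : NormOneClass (UnitalAlg d s) where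
  norm_one := by
    rw [unitization_norm_def]
    have : ofLp (1 : UnitalAlg d s) = 1 := rfl
    simp [this]

/-- The inclusion of `𝒜_s(ℝ^d)`. -/
def incl (u : FourierAlg d s) : UnitalAlg d s := toLp 1 (u : Unitization ℂ (FourierAlg d s))

lemma norm_incl (u : FourierAlg d s) : ‖incl u‖ = ‖u‖ := unitization_norm_inr u

/-- The extension of an endomorphism fixing the constants. -/
def extend (φ : FourierAlg d s →ₙₐ[ℂ] FourierAlg d s) : UnitalAlg d s →ₐ[ℂ] UnitalAlg d s :=
  ((unitizationAlgEquiv ℂ).symm.toAlgHom.comp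
    (Unitization.lift ((Unitization.inrNonUnitalAlgHom ℂ (FourierAlg d s)).comp φ))).comp
    (unitizationAlgEquiv ℂ).toAlgHom

lemma ofLp_extend (φ : FourierAlg d s →ₙₐ[ℂ] FourierAlg d s) (b : UnitalAlg d s) :
    ofLp (extend φ b) = inl (ofLp b).fst + ((φ (ofLp b).snd : FourierAlg d s) : Unitization ℂ _) := by
  rfl

/-- Evaluation at `ξ`. -/
def char (ξ : Space d) : UnitalAlg d s →ₐ[ℂ] ℂ :=
  (Unitization.lift
    { toFun := fun u : FourierAlg d s => u.ev ξ
      map_smul' := fun c u => FourierAlg.ev_smul c u ξ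
      map_zero' := FourierAlg.ev_zero ξ
      map_add' := fun u v => FourierAlg.ev_add u v ξ
      map_mul' := fun u v => FourierAlg.ev_mul u v ξ }).comp
    (unitizationAlgEquiv ℂ).toAlgHom

lemma char_apply (ξ : Space d) (b : UnitalAlg d s) :
    char ξ b = (ofLp b).fst + (ofLp b).snd.ev ξ := by
  rfl

lemma char_incl (ξ : Space d) (u : FourierAlg d s) : char ξ (incl u) = u.ev ξ := by
  rw [char_apply]; simp [incl]

lemma norm_char_le (ξ : Space d) (b : UnitalAlg d s) : ‖char ξ b‖ ≤ ‖b‖ := by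
  rw [char_apply, unitization_norm_def]
  exact (norm_add_le _ _).trans (by gcongr; exact FourierAlg.norm_ev_le _ _)

/-- The constant term. -/
def const : UnitalAlg d s →ₐ[ℂ] ℂ :=
  (Unitization.fstHom ℂ (FourierAlg d s)).comp (unitizationAlgEquiv ℂ).toAlgHom

lemma const_apply (b : UnitalAlg d s) : const b = (ofLp b).fst := rfl

lemma norm_const_le (b : UnitalAlg d s) : ‖const b‖ ≤ ‖b‖ := by
  rw [const_apply, unitization_norm_def]
  exact le_add_of_nonneg_right (norm_nonneg _)

lemma const_incl (u : FourierAlg d s) : const (incl u) = 0 := by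
  rw [const_apply]; simp [incl]

lemma exists_incl_eq {b : UnitalAlg d s} (hb : const b = 0) : ∃ u, incl u = b := by
  refine ⟨(ofLp b).snd, ?_⟩
  apply WithLp.ofLp_injective
  rw [const_apply] at hb
  ext
  · simp [incl, hb]
  · simp [incl]

lemma ext_ofLp {b c : UnitalAlg d s} (h1 : (ofLp b).fst = (ofLp c).fst)
    (h2 : ∀ ξ, (ofLp b).snd.ev ξ = (ofLp c).snd.ev ξ) : b = c :=
  WithLp.ofLp_injective _ (Unitization.ext h1 (FourierAlg.ev_ext h2))

variable (d s) in
/-- The action of the lattice by translations `f ↦ f(· - h k)`. -/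
def latticeAction (h : ℝ) : IsoAction (Fin d → ℤ) (UnitalAlg d s) where
  toFun k := extend (FourierAlg.translateHom (h • latticeVec k))
  map_zero b := by
    refine ext_ofLp ?_ fun ξ => ?_ <;> rw [ofLp_extend]
    · simp
    · have := FourierAlg.ev_translate (h • latticeVec 0) (ofLp b).snd ξ
      rw [latticeVec_zero, smul_zero, sub_zero] at this
      simpa [FourierAlg.translateHom, latticeVec_zero] using this
  map_add k l b := by
    refine ext_ofLp ?_ fun ξ => ?_ <;> rw [ofLp_extend, ofLp_extend, ofLp_extend]
    · simp
    · simp [FourierAlg.translateHom, FourierAlg.ev_translate, latticeVec_add, sub_sub]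
  norm_map k b := by
    rw [unitization_norm_def, unitization_norm_def, ofLp_extend]
    simp [FourierAlg.translateHom, FourierAlg.norm_translate]

lemma const_action (h : ℝ) (k : Fin d → ℤ) (b : UnitalAlg d s) :
    const ((latticeAction d s h).toFun k b) = const b := by
  rw [const_apply, const_apply, latticeAction, ofLp_extend]
  simp

lemma char_action (h : ℝ) (ξ : Space d) (k : Fin d → ℤ) (b : UnitalAlg d s) :
    char ξ ((latticeAction d s h).toFun k b) = char (ξ - h • latticeVec k) b := by
  rw [char_apply, char_apply, latticeAction, ofLp_extend]
  simp [FourierAlg.translateHom, FourierAlg.ev_translate]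

end UnitalAlg

open UnitalAlg in
/-- The counterterm for a symbol with coefficients `v_k ∈ 𝒜_s(ℝ^d)` belongs to `𝒜_s(ℝ^d)`. -/
theorem exists_counterterm_fourierAlg {d : ℕ} {s : ℝ} [hs : Fact (0 < s)] (h : ℝ)
    {ω : Space d} {ς γ ρ ε : ℝ} (hς : 0 < ς) (hγ : 1 < γ) (hω : IsDiophantine ω ς γ)
    (hρ : 0 < ρ) (hε : 0 ≤ ε)
    (hεV : ε ≤ ς / 64 * (Real.sqrt ρ / (2 * (γ - 1))) ^ (2 * (γ - 1)))
    {v : (Fin d → ℤ) → FourierAlg d s}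
    (hv : ∑' k, ‖v k‖ₑ * ENNReal.ofReal (Real.exp (‖latticeVec k‖ * ρ)) ≤ ENNReal.ofReal ε) :
    ∃ (V W Z : Crossed (latticeAction d s h)) (r : FourierAlg d s), (∀ k, V k = incl (v k)) ∧
      W * Z = 1 ∧ Z * W = 1 ∧ ‖W - 1‖ ≤ 1 / 10 ∧ ‖r‖ ≤ 2 * ε ∧
      ∀ k, (W * (V - Crossed.diag (latticeAction d s h) (incl r))) k = (frequency ω k : ℂ) • W k := by
  have hincl : ∀ k, ‖incl (v k)‖ₑ = ‖v k‖ₑ := fun k => by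
    rw [← ofReal_norm, norm_incl, ofReal_norm]
  have hfin : ∑' k, ‖incl (v k)‖ₑ ≠ ∞ := by
    refine (lt_of_le_of_lt (le_trans (ENNReal.tsum_le_tsum fun k => ?_) hv)
      ENNReal.ofReal_lt_top).ne
    rw [hincl]
    refine le_mul_of_one_le_right zero_le ?_
    rw [ENNReal.one_le_ofReal]
    exact Real.one_le_exp (by positivity)
  let V := Crossed.mk (latticeAction d s h) (fun k => incl (v k)) hfin
  have hV : Crossed.Bd (fun k => ‖latticeVec k‖) ρ V ε := by
    refine le_trans (le_of_eq ?_) hv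
    unfold Crossed.wnorm
    simp only [V, Crossed.mk_apply, hincl]
  obtain ⟨W, Z, R, hWZ, hZW, hW, hR, hD⟩ := Crossed.exists_counterterm (lam := frequency ω)
    (τ := γ - 1) (by linarith) hς hρ hε hεV (by simp [latticeVec_zero])
    (fun k hk => norm_pos_iff.mpr (latticeVec_ne_zero hk))
    (fun k l => by rw [latticeVec_add]; exact norm_add_le _ _)
    (fun k hk => by
      have := hω k hk
      rwa [real_inner_comm] at this) hV
  let c : UnitalAlg d s →L[ℂ] ℂ := (const : UnitalAlg d s →ₐ[ℂ] ℂ).toLinearMap.mkContinuous 1 fun b => by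
    rw [one_mul]; exact norm_const_le b
  -- The derivation has no component at k = 0, so the mean of W (V - R) vanishes.
  have h0 : (W * V) 0 = W 0 * R := by
    have := hD 0
    rw [mul_sub, Crossed.sub_apply, Crossed.mul_diag_apply, map_zero, (latticeAction d s h).map_zero]
      at this
    rw [← sub_eq_zero, this]
    simp
  -- The constant term is a translation-invariant character that vanishes on every coefficient of V.
  have h1 : const ((W * V) 0) = 0 := by
    have := (Crossed.hasSum_mul_apply W V 0).mapL c
    change c _ = 0
    refine this.unique ?_
    have hz : ∀ m, c (W m * (latticeAction d s h).toFun m (V (0 - m))) = 0 := fun m => by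
      change const _ = 0
      rw [map_mul, const_action, Crossed.mk_apply, const_incl, mul_zero]
    simp only [hz]
    exact hasSum_zero
  -- A vanishing constant term would put W₀ at distance at least 1 from the unit.
  have h2 : const (W 0) ≠ 0 := by
    intro h2
    have := (norm_const_le _).trans ((Crossed.norm_apply_le (W - 1) 0).trans hW)
    rw [Crossed.sub_apply, map_sub, h2, Crossed.one_def, Crossed.diag_apply_zero, map_one] at this
    norm_num at this
  have h3 : const R = 0 := by
    rw [h0, map_mul] at h1
    exact (mul_eq_zero.mp h1).resolve_left h2
  obtain ⟨r, rfl⟩ := exists_incl_eq h3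
  exact ⟨V, W, Z, r, fun k => rfl, hWZ, hZW, hW, by rwa [norm_incl] at hR, hD⟩

end

noncomputable section

/-! ### Matrices of bounded operators -/

section Hilbert

open ContinuousLinearMap

variable {G H : Type*} [NormedAddCommGroup H] [InnerProductSpace ℂ H]
  (b : HilbertBasis G ℂ H)

/-- The matrix of a bounded operator. -/
def entry (X : H →L[ℂ] H) (j k : G) : ℂ := ⟪b j, X (b k)⟫_ℂ

lemma inner_basis [DecidableEq G] (j k : G) : ⟪b j, b k⟫_ℂ = if j = k then 1 else 0 :=
  orthonormal_iff_ite.mp b.orthonormal j k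

variable {b} in
lemma ext_inner_basis {x y : H} (h : ∀ j, ⟪b j, x⟫_ℂ = ⟪b j, y⟫_ℂ) : x = y := by
  apply b.repr.injective
  ext j
  rw [b.repr_apply_apply, b.repr_apply_apply, h]

variable {b} in
lemma ext_entry {X Y : H →L[ℂ] H} (h : ∀ j k, entry b X j k = entry b Y j k) : X = Y := by
  refine ContinuousLinearMap.ext_on
    (Submodule.dense_iff_topologicalClosure_eq_top.mpr b.dense_span) ?_
  rintro _ ⟨k, rfl⟩
  exact ext_inner_basis (b := b) fun j => h j k

lemma norm_entry_le (X : H →L[ℂ] H) (j k : G) : ‖entry b X j k‖ ≤ ‖X‖ := by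
  refine (norm_inner_le_norm _ _).trans ?_
  have hn : ∀ i, ‖b i‖ = 1 := b.orthonormal.1
  rw [hn, one_mul]
  exact (X.le_opNorm _).trans (by rw [hn, mul_one])

lemma entry_add (X Y : H →L[ℂ] H) (j k : G) :
    entry b (X + Y) j k = entry b X j k + entry b Y j k := inner_add_right _ _ _

lemma entry_sub (X Y : H →L[ℂ] H) (j k : G) :
    entry b (X - Y) j k = entry b X j k - entry b Y j k := inner_sub_right _ _ _

lemma entry_neg (X : H →L[ℂ] H) (j k : G) : entry b (-X) j k = -entry b X j k :=
  inner_neg_right _ _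

variable [CompleteSpace H]

lemma entry_adjoint (X : H →L[ℂ] H) (j k : G) :
    entry b (adjoint X) j k = starRingEnd ℂ (entry b X k j) := by
  rw [entry, entry, adjoint_inner_right, inner_conj_symm]

lemma hasSum_entry_apply (X : H →L[ℂ] H) (x : H) (j : G) :
    HasSum (fun l => entry b X j l * ⟪b l, x⟫_ℂ) ⟪b j, X x⟫_ℂ := by
  have := b.hasSum_inner_mul_inner (adjoint X (b j)) x
  simp only [adjoint_inner_left] at this
  exact this

lemma hasSum_entry_mul (X Y : H →L[ℂ] H) (j k : G) :
    HasSum (fun l => entry b X j l * entry b Y l k) (entry b (X * Y) j k) :=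
  hasSum_entry_apply b X (Y (b k)) j

/-- A single diagonal of a matrix: a shift of ℓ² followed by multiplication by a bounded sequence.
It supplies both the terms of `crossedOp` and, for m = 0, all diagonal operators. -/
lemma exists_weightedShift [AddGroup G] {f : G → ℂ} {C : ℝ} (hC : ∀ j, ‖f j‖ ≤ C) (m : G) :
    ∃ S : H →L[ℂ] H, (∀ x j, ⟪b j, S x⟫_ℂ = f j * ⟪b (j - m), x⟫_ℂ) ∧ ‖S‖ ≤ C := by
  have hC0 : 0 ≤ C := (norm_nonneg _).trans (hC 0)
  have hsum : ∀ x : lp (fun _ : G => ℂ) 2, HasSum (fun j => ‖x (j - m)‖ ^ 2) (‖x‖ ^ 2) := fun x => by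
    have h1 := lp.hasSum_norm (p := 2) (by simp) x
    simp only [ENNReal.toReal_ofNat, Real.rpow_ofNat] at h1
    exact (Equiv.subRight m).hasSum_iff.mpr h1
  have hle : ∀ (x : lp (fun _ : G => ℂ) 2) j,
      ‖f j * x (j - m)‖ ^ 2 ≤ C ^ 2 * ‖x (j - m)‖ ^ 2 := fun x j => by
    rw [norm_mul, mul_pow]
    gcongr
    exact hC j
  have hmem : ∀ x : lp (fun _ : G => ℂ) 2, Memℓp (fun j => f j * x (j - m)) 2 := fun x => by
    refine memℓp_gen ?_
    simp only [ENNReal.toReal_ofNat, Real.rpow_ofNat]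
    exact .of_nonneg_of_le (fun _ => by positivity) (hle x) ((hsum x).summable.mul_left _)
  let L : lp (fun _ : G => ℂ) 2 →ₗ[ℂ] lp (fun _ : G => ℂ) 2 :=
    { toFun := fun x => ⟨fun j => f j * x (j - m), hmem x⟩
      map_add' := fun x y => by
        ext j
        exact mul_add _ _ _
      map_smul' := fun c x => by
        ext j
        exact mul_left_comm _ _ _ }
  have hL : ∀ x, ‖L x‖ ≤ C * ‖x‖ := fun x => by
    refine lp.norm_le_of_tsum_le (by simp) (by positivity) ?_
    simp only [ENNReal.toReal_ofNat, Real.rpow_ofNat]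
    rw [mul_pow, ← (hsum x).tsum_eq, ← tsum_mul_left]
    refine Summable.tsum_le_tsum (hle x) ?_ ((hsum x).summable.mul_left _)
    exact .of_nonneg_of_le (fun _ => by positivity) (hle x) ((hsum x).summable.mul_left _)
  let M := L.mkContinuous C hL
  let e := b.repr.toContinuousLinearEquiv
  refine ⟨(e.symm : lp (fun _ : G => ℂ) 2 →L[ℂ] H) ∘L M ∘L (e : H →L[ℂ] lp (fun _ : G => ℂ) 2),
    fun x j => ?_, ?_⟩
  · rw [← b.repr_apply_apply, ← b.repr_apply_apply]
    have : b.repr (b.repr.symm (M (b.repr x))) = M (b.repr x) := b.repr.apply_symm_apply _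
    change b.repr (b.repr.symm (M (b.repr x))) j = _
    rw [this]
    rfl
  · refine opNorm_le_bound _ hC0 fun x => ?_
    change ‖b.repr.symm (M (b.repr x))‖ ≤ _
    rw [b.repr.symm.norm_map]
    exact (hL _).trans (by rw [b.repr.norm_map])

end Hilbert

/-! ### Representations of the crossed product -/

section Representation

variable {G B H : Type*} [AddCommGroup G] [NormedRing B] [NormedAlgebra ℂ B] [CompleteSpace B]
  {T : IsoAction G B} [NormedAddCommGroup H] [InnerProductSpace ℂ H] [CompleteSpace H]
  (b : HilbertBasis G ℂ H) {χ : G → B →ₐ[ℂ] ℂ}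

/-- Summing over the diagonals, the m-th one has norm at most ‖a_m‖, so the series converges
absolutely in operator norm. -/
lemma exists_crossedOp (hχ : ∀ j c, ‖χ j c‖ ≤ ‖c‖) (a : Crossed T) :
    ∃ A : H →L[ℂ] H, (∀ j k, entry b A j k = χ j (a (j - k))) ∧ ‖A‖ ≤ ‖a‖ := by
  classical
  choose S hS hSn using fun m => exists_weightedShift b (f := fun j => χ j (a m))
    (fun j => hχ j (a m)) m
  have hs : Summable S := .of_norm_bounded a.summable_norm hSn
  refine ⟨∑' m, S m, fun j k => ?_, ?_⟩
  · have h1 := (hs.hasSum.mapL (ContinuousLinearMap.apply ℂ H (b k))).mapL (innerSL ℂ (b j))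
    have h2 : ∀ m, innerSL ℂ (b j) ((ContinuousLinearMap.apply ℂ H (b k)) (S m)) =
        if m = j - k then χ j (a (j - k)) else 0 := fun m => by
      change ⟪b j, S m (b k)⟫_ℂ = _
      rw [hS, inner_basis]
      by_cases h : m = j - k
      · subst h; simp
      · rw [if_neg h, if_neg, mul_zero]
        rintro rfl
        exact h (by abel)
    simp only [h2] at h1
    exact h1.unique (hasSum_ite_eq _ _)
  · rw [Crossed.norm_eq]
    exact tsum_of_norm_bounded a.summable_norm.hasSum hSn

/-- The operator with matrix `χ_j(a_{j-k})`. -/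
def crossedOp (hχ : ∀ j c, ‖χ j c‖ ≤ ‖c‖) (a : Crossed T) : H →L[ℂ] H :=
  (exists_crossedOp b hχ a).choose

variable (hχ : ∀ j c, ‖χ j c‖ ≤ ‖c‖)

lemma entry_crossedOp (a : Crossed T) (j k : G) :
    entry b (crossedOp b hχ a) j k = χ j (a (j - k)) :=
  (exists_crossedOp b hχ a).choose_spec.1 j k

lemma norm_crossedOp_le (a : Crossed T) : ‖crossedOp b hχ a‖ ≤ ‖a‖ :=
  (exists_crossedOp b hχ a).choose_spec.2

lemma crossedOp_sub (a c : Crossed T) :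
    crossedOp b hχ (a - c) = crossedOp b hχ a - crossedOp b hχ c :=
  ext_entry (b := b) fun j k => by
    simp only [entry_sub, entry_crossedOp, Crossed.sub_apply, map_sub]

lemma crossedOp_one : crossedOp b hχ (1 : Crossed T) = 1 := by
  classical
  refine ext_entry (b := b) fun j k => ?_
  rw [entry_crossedOp, Crossed.one_def, Crossed.diag_apply, entry]
  change _ = ⟪b j, b k⟫_ℂ
  rw [inner_basis]
  by_cases h : j = k
  · simp [h]
  · simp [h, sub_eq_zero]

/-- Covariance of the characters, χ_j ∘ T_m = χ_{j-m}, is exactly what turns twisted convolution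
into matrix multiplication. -/
lemma crossedOp_mul (hT : ∀ j m c, χ j (T.toFun m c) = χ (j - m) c) (a c : Crossed T) :
    crossedOp b hχ (a * c) = crossedOp b hχ a * crossedOp b hχ c := by
  refine ext_entry (b := b) fun j k => ?_
  have h1 := hasSum_entry_mul b (crossedOp b hχ a) (crossedOp b hχ c) j k
  let l : B →L[ℂ] ℂ := (χ j).toLinearMap.mkContinuous 1 fun x => by rw [one_mul]; exact hχ j x
  have h2 := (Crossed.hasSum_mul_apply a c (j - k)).mapL l
  rw [← (Equiv.subLeft j).hasSum_iff] at h2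
  have h3 : (fun m => l (a m * T.toFun m (c (j - k - m)))) ∘ (Equiv.subLeft j) =
      fun m => entry b (crossedOp b hχ a) j m * entry b (crossedOp b hχ c) m k := by
    ext m
    simp only [Function.comp_apply, Equiv.subLeft_apply]
    change χ j _ = _
    rw [map_mul, hT, entry_crossedOp, entry_crossedOp, sub_sub_cancel]
    congr 3
    abel
  rw [h3] at h2
  rw [entry_crossedOp]
  exact h2.unique h1

end Representation

/-! ### Intertwining with a diagonal operator -/

section Intertwine

open ContinuousLinearMap

variable {G H : Type*} [AddCommGroup G] [NormedAddCommGroup H] [InnerProductSpace ℂ H]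
  [CompleteSpace H] (b : HilbertBasis G ℂ H) (lam : G →+ ℝ)

/-- `[L, X] = Y` for the diagonal operator `L` with eigenvalues `lam k`. -/
def HasCommutator (X Y : H →L[ℂ] H) : Prop :=
  ∀ j k, ((lam j : ℂ) - lam k) * entry b X j k = entry b Y j k

variable {b lam}

lemma HasCommutator.mul {X X' Y Y' : H →L[ℂ] H} (h : HasCommutator b lam X Y)
    (h' : HasCommutator b lam X' Y') : HasCommutator b lam (X * X') (Y * X' + X * Y') := by
  intro j k
  rw [entry_add]
  refine ((hasSum_entry_mul b X X' j k).mul_left _).unique ?_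
  refine ((hasSum_entry_mul b Y X' j k).add (hasSum_entry_mul b X Y' j k)).congr_fun fun l => ?_
  rw [← h j l, ← h' l k]
  ring

lemma HasCommutator.adjoint {X Y : H →L[ℂ] H} (h : HasCommutator b lam X Y) :
    HasCommutator b lam (adjoint X) (-adjoint Y) := by
  intro j k
  rw [entry_neg, entry_adjoint, entry_adjoint, ← h k j]
  simp only [map_mul, map_sub, Complex.conj_ofReal]
  ring

/-- Operators with bounded commutator preserve the domain of `L`. -/
lemma HasCommutator.inner_apply {X Y : H →L[ℂ] H} (h : HasCommutator b lam X Y) {x y : H}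
    (hxy : ∀ k, ⟪b k, y⟫_ℂ = (lam k : ℂ) * ⟪b k, x⟫_ℂ) (j : G) :
    ⟪b j, X y + Y x⟫_ℂ = (lam j : ℂ) * ⟪b j, X x⟫_ℂ := by
  rw [inner_add_right]
  refine ((hasSum_entry_apply b X y j).add (hasSum_entry_apply b Y x j)).unique ?_
  refine ((hasSum_entry_apply b X x j).mul_left (lam j : ℂ)).congr_fun fun l => ?_
  rw [← h j l, hxy]
  ring

/-- The norm of a diagonal operator is the supremum of its entries, so the hypothesis gives ‖D‖ ≤
c‖D‖ with c < 1. -/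
lemma eq_zero_of_diagonal {D : H →L[ℂ] H} {c : ℝ} (hD : ∀ j k, j ≠ k → entry b D j k = 0)
    (hc : c < 1) (h : ∀ j, ‖entry b D j j‖ ≤ c * ‖D‖) : D = 0 := by
  classical
  obtain ⟨S, hS, hSn⟩ := exists_weightedShift b (f := fun j => entry b D j j) h 0
  have : D = S := ext_entry (b := b) fun j k => by
    rw [entry.eq_def b S, hS, sub_zero, inner_basis]
    by_cases hjk : j = k
    · simp [hjk]
    · simp [hjk, hD j k hjk]
  rw [← this] at hSn
  have h0 := norm_nonneg D
  exact norm_eq_zero.mp (by nlinarith)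

variable (hlam : ∀ k, k ≠ 0 → lam k ≠ 0)

include hlam in
lemma HasCommutator.entry_eq_zero {X : H →L[ℂ] H} (h : HasCommutator b lam X 0) {j k : G}
    (hjk : j ≠ k) : entry b X j k = 0 := by
  have h1 := h j k
  have h2 : ((lam j : ℂ) - lam k) ≠ 0 := by
    have := hlam (j - k) (sub_ne_zero.mpr hjk)
    rw [map_sub] at this
    exact_mod_cast this
  have h3 : entry b (0 : H →L[ℂ] H) j k = 0 := by simp [entry]
  rw [h3] at h1
  exact (mul_eq_zero.mp h1).resolve_left h2

variable {W A D : H →L[ℂ] H}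

/-- The counterterm is self-adjoint. -/
lemma counterterm_selfAdjoint (hA : adjoint A = A) (hD : ∀ j k, j ≠ k → entry b D j k = 0)
    (hW : ‖W - 1‖ ≤ 1 / 10) (h : HasCommutator b lam W (W * (A - D))) : adjoint D = D := by
  have hmul : ∀ X Y : H →L[ℂ] H, adjoint (X * Y) = adjoint Y * adjoint X := fun X Y =>
    star_mul X Y
  rw [← sub_eq_zero]
  set Δ := adjoint D - D with hΔ
  have hΔd : ∀ j k, j ≠ k → entry b Δ j k = 0 := fun j k hjk => by
    rw [hΔ, entry_sub, entry_adjoint, hD j k hjk, hD k j hjk.symm]; simp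
  refine eq_zero_of_diagonal (c := 21 / 100) hΔd (by norm_num) fun j => ?_
  -- The commutator of L with W W* is W Δ W*, and a commutator with L has zero diagonal. The
  -- diagonal of Δ is therefore that of Δ - W Δ W*, which is at most 21/100 ‖Δ‖ because W is near 1.
  have h1 := h.mul h.adjoint j j
  rw [sub_self, zero_mul] at h1
  have h2 : W * (A - D) * adjoint W + W * -adjoint (W * (A - D)) = W * Δ * adjoint W := by
    rw [hmul, map_sub, hA, hΔ]; noncomm_ring
  rw [h2] at h1
  have h3 : entry b Δ j j = entry b (Δ - W * Δ * adjoint W) j j := by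
    rw [entry_sub b Δ, ← h1, sub_zero]
  rw [h3]
  refine (norm_entry_le b _ j j).trans ?_
  have h4 : Δ - W * Δ * adjoint W = -((W - 1) * Δ * adjoint (W - 1) + (W - 1) * Δ
      + Δ * adjoint (W - 1)) := by
    have : adjoint (W - 1) = adjoint W - 1 := by
      rw [map_sub]; congr 1; exact star_one (H →L[ℂ] H)
    rw [this]; noncomm_ring
  have hW' : ‖adjoint (W - 1)‖ ≤ 1 / 10 := by rwa [LinearIsometryEquiv.norm_map]
  have n1 : ‖(W - 1) * Δ * adjoint (W - 1)‖ ≤ 1 / 10 * ‖Δ‖ * (1 / 10) := by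
    refine (norm_mul_le _ _).trans ?_
    gcongr
    refine (norm_mul_le _ _).trans ?_
    gcongr
  have n2 : ‖(W - 1) * Δ‖ ≤ 1 / 10 * ‖Δ‖ := (norm_mul_le _ _).trans (by gcongr)
  have n3 : ‖Δ * adjoint (W - 1)‖ ≤ ‖Δ‖ * (1 / 10) := (norm_mul_le _ _).trans (by gcongr)
  rw [h4, norm_neg]
  refine norm_add₃_le.trans ((add_le_add_three n1 n2 n3).trans (le_of_eq ?_))
  ring

include hlam in
/-- An invertible conjugation `W (L + A) W⁻¹ = L` between self-adjoint operators may be replaced by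
the unitary one in its polar decomposition. -/
lemma exists_unitary {Z : H →L[ℂ] H} (hA : adjoint A = A) (hZW : Z * W = 1)
    (hW : ‖W - 1‖ ≤ 1 / 10) (h : HasCommutator b lam W (W * A)) :
    ∃ U : H →L[ℂ] H, adjoint U * U = 1 ∧ U * adjoint U = 1 ∧ HasCommutator b lam U (U * A) := by
  classical
  have hmul : ∀ X Y : H →L[ℂ] H, adjoint (X * Y) = adjoint Y * adjoint X := fun X Y =>
    star_mul X Y
  set P := W * adjoint W with hP
  -- For self-adjoint A the two terms of [L, W W*] cancel, and an operator commuting with L is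
  -- diagonal by nonresonance.
  have hPd : ∀ {j k}, j ≠ k → entry b P j k = 0 := fun {j k} hjk => by
    have h1 := h.mul h.adjoint
    have h2 : W * A * adjoint W + W * -adjoint (W * A) = 0 := by
      rw [hmul, hA]; noncomm_ring
    rw [h2] at h1
    exact h1.entry_eq_zero hlam hjk
  have hn : ∀ i, ‖b i‖ = 1 := b.orthonormal.1
  have hp : ∀ j, entry b P j j = ((‖adjoint W (b j)‖ ^ 2 : ℝ) : ℂ) := fun j => by
    change ⟪b j, W (adjoint W (b j))⟫_ℂ = _
    rw [← adjoint_inner_left, inner_self_eq_norm_sq_to_K]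
    norm_cast
  have hlow : ∀ j, 9 / 10 ≤ ‖adjoint W (b j)‖ := fun j => by
    have h1 : ‖adjoint W (b j) - b j‖ ≤ 1 / 10 := by
      have h2 : adjoint (W - 1) (b j) = adjoint W (b j) - b j := by
        have : adjoint (W - 1) = adjoint W - 1 := by
          rw [map_sub]; congr 1; exact star_one (H →L[ℂ] H)
        rw [this]; rfl
      rw [← h2]
      refine (le_opNorm _ _).trans ?_
      rw [hn, mul_one, LinearIsometryEquiv.norm_map]
      exact hW
    have h3 := norm_sub_norm_le (b j) (b j - adjoint W (b j))
    rw [sub_sub_cancel, norm_sub_rev, hn] at h3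
    linarith
  -- The diagonal of P^{-1/2}, since P has diagonal entries ‖W* b_j‖²; they are bounded below
  -- because W is near 1.
  let q : G → ℝ := fun j => ‖adjoint W (b j)‖⁻¹
  have hq0 : ∀ j, 0 < q j := fun j => inv_pos.mpr (by linarith [hlow j])
  obtain ⟨Q, hQ, -⟩ := exists_weightedShift b (f := fun j => (q j : ℂ)) (C := 10 / 9)
    (fun j => by
      rw [Complex.norm_real, Real.norm_of_nonneg (hq0 j).le]
      have := inv_anti₀ (by norm_num) (hlow j)
      exact this.trans (by norm_num)) 0
  simp only [sub_zero] at hQ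
  have hQb : ∀ k, Q (b k) = (q k : ℂ) • b k := fun k => ext_inner_basis (b := b) fun j => by
    rw [hQ, inner_smul_right, inner_basis]
    by_cases hjk : j = k
    · rw [hjk]
    · simp [hjk]
  have hQa : adjoint Q = Q := ext_entry (b := b) fun j k => by
    rw [entry_adjoint, entry, entry, hQ, hQ, map_mul, Complex.conj_ofReal, inner_conj_symm,
      inner_basis]
    by_cases hjk : j = k
    · rw [hjk]
    · simp [hjk]
  have hUU : Q * W * adjoint (Q * W) = 1 := by
    refine ext_entry (b := b) fun j k => ?_
    have h1 : Q * W * adjoint (Q * W) = Q * P * Q := by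
      rw [hmul, hQa, hP]; noncomm_ring
    rw [h1]
    change ⟪b j, Q (P (Q (b k)))⟫_ℂ = ⟪b j, b k⟫_ℂ
    rw [hQ, hQb, map_smul, inner_smul_right, inner_basis]
    change _ * (_ * entry b P j k) = _
    by_cases hjk : j = k
    · subst hjk
      rw [hp, if_pos rfl]
      have h2 : q j * (q j * ‖adjoint W (b j)‖ ^ 2) = 1 := by
        have : ‖adjoint W (b j)‖ ≠ 0 := by have := hlow j; positivity
        simp only [q]
        field_simp
      exact_mod_cast h2
    · rw [hPd hjk, if_neg hjk]; simp
  refine ⟨Q * W, ?_, hUU, ?_⟩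
  -- U U* = 1 makes U surjective; the left inverse Z makes it injective, whence U* U = 1.
  · ext x
    have hinj : ∀ x y : H, (Q * W) x = (Q * W) y → x = y := fun x y hxy => by
      have h1 : W x = W y := ext_inner_basis (b := b) fun j => by
        have := congrArg (fun z => ⟪b j, z⟫_ℂ) hxy
        simp only [mul_apply_eq_comp, hQ] at this
        exact mul_left_cancel₀ (by exact_mod_cast (hq0 j).ne') this
      have h2 : ∀ z, Z (W z) = z := fun z => by
        have := congrArg (fun X : H →L[ℂ] H => X z) hZW
        exact this
      rw [← h2 x, h1, h2]
    refine hinj _ _ ?_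
    have := congrArg (fun X : H →L[ℂ] H => X ((Q * W) x)) hUU
    exact this
  · have hQc : HasCommutator b lam Q 0 := fun j k => by
      rw [entry, hQ, inner_basis]
      by_cases hjk : j = k
      · subst hjk; simp [entry]
      · simp [entry, hjk]
    have := hQc.mul h
    rwa [zero_mul, zero_add, ← mul_assoc] at this

end Intertwine

end

noncomputable section

/-! ### Analyticity -/

section Analytic

open VectorFourier

variable {d : ℕ} {s : ℝ}

/-- The duality pairing normalized so that Mathlib's Fourier transform has kernel `e^{i η·ξ}`. -/
def pairing (d : ℕ) : Space d →L[ℝ] Space d →L[ℝ] ℝ := (-(2 * Real.pi)⁻¹) • innerSL ℝ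

lemma pairing_apply (η y : Space d) : pairing d η y = -(2 * Real.pi)⁻¹ * ⟪η, y⟫_ℝ := rfl

lemma norm_pairing_le (d : ℕ) : 2 * Real.pi * ‖pairing d‖ ≤ 1 := by
  have hpi := Real.pi_pos
  have h1 : ‖pairing d‖ ≤ (2 * Real.pi)⁻¹ :=
    ContinuousLinearMap.opNorm_le_bound₂ _ (by positivity) fun η y => by
      rw [pairing_apply, norm_mul, norm_neg, Real.norm_of_nonneg (by positivity), mul_assoc]
      gcongr
      exact norm_inner_le_norm η y
  calc 2 * Real.pi * ‖pairing d‖ ≤ 2 * Real.pi * (2 * Real.pi)⁻¹ := by gcongr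
    _ = 1 := mul_inv_cancel₀ (by positivity)

lemma taylorTerm_apply (φ : Space d → ℂ) (η y : Space d) (n : ℕ) :
    (((n.factorial : ℝ)⁻¹) • fourierPowSMulRight (pairing d) φ η n) (fun _ => y) =
      (Complex.I * (⟪η, y⟫_ℝ : ℝ)) ^ n / n.factorial * φ η := by
  rw [smul_apply, fourierPowSMulRight_apply]
  simp only [pairing_apply, Finset.prod_const, Finset.card_univ, Fintype.card_fin]
  have h1 : (Complex.I * (⟪η, y⟫_ℝ : ℝ)) ^ n =
      (-(2 * Real.pi * Complex.I)) ^ n * (((-(2 * Real.pi)⁻¹) * ⟪η, y⟫_ℝ : ℝ) : ℂ) ^ n := by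
    rw [← mul_pow]
    congr 1
    have : (Real.pi : ℂ) ≠ 0 := by exact_mod_cast Real.pi_ne_zero
    push_cast
    field_simp
  rw [h1]
  simp only [smul_eq_mul, Complex.real_smul]
  push_cast
  ring

lemma norm_taylorTerm_le (hs : 0 < s) (φ : Space d → ℂ) (η : Space d) (n : ℕ) :
    ‖((n.factorial : ℝ)⁻¹) • fourierPowSMulRight (pairing d) φ η n‖ ≤
      (s⁻¹) ^ n * (Real.exp (‖η‖ * s) * ‖φ η‖) := by
  rw [norm_smul, norm_inv, Real.norm_of_nonneg (by positivity)]
  have h1 := norm_fourierPowSMulRight_le (pairing d) φ η n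
  have h2 : (2 * Real.pi * ‖pairing d‖) ^ n ≤ 1 := by
    have := Real.pi_pos
    exact pow_le_one₀ (by positivity) (norm_pairing_le d)
  have h3 := Real.pow_div_factorial_le_exp (x := ‖η‖ * s) (by positivity) n
  have hs' : s ^ n * (s⁻¹) ^ n = 1 := by rw [← mul_pow, mul_inv_cancel₀ hs.ne', one_pow]
  calc (n.factorial : ℝ)⁻¹ * ‖fourierPowSMulRight (pairing d) φ η n‖
      ≤ (n.factorial : ℝ)⁻¹ * (1 * ‖η‖ ^ n * ‖φ η‖) := by
        gcongr; exact h1.trans (by gcongr)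
    _ = ((‖η‖ * s) ^ n / n.factorial) * ((s⁻¹) ^ n * ‖φ η‖) := by
        rw [mul_pow]
        calc _ = (n.factorial : ℝ)⁻¹ * ‖η‖ ^ n * (s ^ n * (s⁻¹) ^ n) * ‖φ η‖ := by rw [hs']; ring
          _ = _ := by ring
    _ ≤ Real.exp (‖η‖ * s) * ((s⁻¹) ^ n * ‖φ η‖) := by gcongr
    _ = _ := by ring

/-- Expand e^{iη·y} under the integral. Since (s|η|)ⁿ/n! ≤ e^{s|η|}, the n-th term is O(s⁻ⁿ), so the
Taylor series has radius at least s at every point. -/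
lemma analyticAt_integral_mul_exp (hs : 0 < s) {g : Space d → ℂ} (hg : Integrable g)
    (hgs : Integrable fun η => Real.exp (‖η‖ * s) * ‖g η‖) (ξ₀ : Space d) :
    AnalyticAt ℝ (fun ξ => ∫ η, g η * Complex.exp (Complex.I * (⟪η, ξ⟫_ℝ : ℝ))) ξ₀ := by
  let φ : Space d → ℂ := fun η => g η * Complex.exp (Complex.I * (⟪η, ξ₀⟫_ℝ : ℝ))
  have hφ : Integrable φ := integrable_mul_exp hg ξ₀
  have hφn : ∀ η, ‖φ η‖ = ‖g η‖ := fun η => by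
    simp only [φ, norm_mul]
    rw [mul_comm Complex.I, Complex.norm_exp_ofReal_mul_I, mul_one]
  let q : ∀ n : ℕ, Space d → ContinuousMultilinearMap ℝ (fun _ : Fin n => Space d) ℂ :=
    fun n η => ((n.factorial : ℝ)⁻¹) • fourierPowSMulRight (pairing d) φ η n
  have hqn : ∀ n η, ‖q n η‖ ≤ (s⁻¹) ^ n * (Real.exp (‖η‖ * s) * ‖g η‖) := fun n η => by
    rw [← hφn]; exact norm_taylorTerm_le hs φ η n
  have hqi : ∀ n, Integrable (q n) := fun n =>
    (hgs.const_mul ((s⁻¹) ^ n)).mono'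
      ((hφ.aestronglyMeasurable.fourierPowSMulRight (pairing d) n).const_smul ((n.factorial : ℝ)⁻¹))
      (Filter.Eventually.of_forall (hqn n))
  set K := ∫ η, Real.exp (‖η‖ * s) * ‖g η‖ with hK
  have hK0 : 0 ≤ K := integral_nonneg fun η => by positivity
  let p : FormalMultilinearSeries ℝ (Space d) ℂ := fun n => ∫ η, q n η
  have hpa : ∀ n (y : Space d), p n (fun _ => y) = ∫ η, q n η (fun _ => y) := fun n y =>
    ((ContinuousMultilinearMap.apply ℝ (fun _ : Fin n => Space d) ℂ
      (fun _ => y)).integral_comp_comm (hqi n)).symm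
  have hpn : ∀ n, ‖p n‖ ≤ (s⁻¹) ^ n * K := fun n => by
    rw [hK, ← integral_const_mul]
    exact norm_integral_le_of_norm_le (hgs.const_mul _) (Filter.Eventually.of_forall (hqn n))
  have hball : HasFPowerSeriesOnBall
      (fun ξ => ∫ η, g η * Complex.exp (Complex.I * (⟪η, ξ⟫_ℝ : ℝ))) p ξ₀ (s.toNNReal : ℝ≥0∞) := by
    refine ⟨p.le_radius_of_bound K fun n => ?_, by simpa using hs, fun {y} hy => ?_⟩
    · rw [Real.coe_toNNReal s hs.le]
      calc ‖p n‖ * s ^ n ≤ (s⁻¹) ^ n * K * s ^ n := by gcongr; exact hpn n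
        _ = (s⁻¹ * s) ^ n * K := by rw [mul_pow]; ring
        _ = K := by rw [inv_mul_cancel₀ hs.ne', one_pow, one_mul]
    · have hy' : ‖y‖ < s := by
        rw [Metric.mem_eball, edist_zero_right] at hy
        have h1 : ‖y‖ₑ < ENNReal.ofReal s := hy
        rw [← ofReal_norm, ENNReal.ofReal_lt_ofReal_iff hs] at h1
        exact h1
      have hF : ∀ n η, ‖q n η (fun _ => y)‖ ≤
          (‖y‖ / s) ^ n * (Real.exp (‖η‖ * s) * ‖g η‖) := fun n η => by
        refine ((q n η).le_opNorm _).trans ?_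
        simp only [Finset.prod_const, Finset.card_univ, Fintype.card_fin]
        calc _ ≤ (s⁻¹) ^ n * (Real.exp (‖η‖ * s) * ‖g η‖) * ‖y‖ ^ n := by gcongr; exact hqn n η
          _ = _ := by rw [div_eq_mul_inv, mul_pow]; ring
      have hFi : ∀ n, Integrable fun η => q n η (fun _ => y) := fun n =>
        (ContinuousMultilinearMap.apply ℝ (fun _ : Fin n => Space d) ℂ
          (fun _ => y)).integrable_comp (hqi n)
      have hsum : Summable fun n => ∫ η, ‖q n η (fun _ => y)‖ := by
        refine .of_nonneg_of_le (fun n => integral_nonneg fun η => norm_nonneg _) (fun n => ?_)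
          ((summable_geometric_of_lt_one (r := ‖y‖ / s) (by positivity)
            ((div_lt_one hs).mpr hy')).mul_right K)
        rw [hK, ← integral_const_mul]
        exact integral_mono (hFi n).norm (hgs.const_mul _) (hF n)
      have h1 := hasSum_integral_of_summable_integral_norm hFi hsum
      simp_rw [hpa]
      convert h1 using 1
      refine integral_congr_ae (Filter.Eventually.of_forall fun η => ?_)
      have h2 := (NormedSpace.expSeries_div_hasSum_exp
        (Complex.I * (⟪η, y⟫_ℝ : ℝ))).mul_right (φ η)
      simp only [q, taylorTerm_apply]
      rw [h2.tsum_eq, ← Complex.exp_eq_exp_ℂ]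
      simp only [φ, inner_add_right]
      push_cast
      rw [mul_add, Complex.exp_add]
      ring
  exact hball.analyticAt

lemma FourierAlg.analyticOnNhd_ev [hs : Fact (0 < s)] (u : FourierAlg d s) :
    AnalyticOnNhd ℝ u.ev univ := by
  intro ξ _
  refine analyticAt_const.mul (analyticAt_integral_mul_exp hs.out u.integrable_dens ?_ ξ)
  refine (u.integrable_toL1.norm.const_mul (fourierConst d)⁻¹).congr
    (Filter.Eventually.of_forall fun η => ?_)
  simp only [norm_toL1, weight]
  have := (fourierConst_pos d).ne'
  field_simp

end Analytic

/-- The real part of an element of `𝒜_s(ℝ^d)`. -/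
lemma FourierAlg.memSpaceAlg_re {d : ℕ} {s : ℝ} [hs : Fact (0 < s)] (u : FourierAlg d s) :
    MemSpaceAlg s (fun ξ => (u.ev ξ).re) ∧ spaceNorm s (fun ξ => ((u.ev ξ).re : ℂ)) ≤ ‖u‖ₑ := by
  obtain ⟨w, hw, hwn⟩ := exists_conj u
  have h1 : (fun ξ => ((u.ev ξ).re : ℂ)) = ((1 / 2 : ℂ) • (u + w)).ev := by
    ext ξ
    rw [ev_smul, ev_add, hw, Complex.add_conj]
    push_cast; ring
  have h2 : spaceNorm s (fun ξ => ((u.ev ξ).re : ℂ)) ≤ ‖u‖ₑ := by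
    rw [h1, spaceNorm_ev, ← ofReal_norm, ← ofReal_norm]
    refine ENNReal.ofReal_le_ofReal ?_
    rw [norm_smul]
    have := norm_add_le u w
    norm_num
    linarith
  refine ⟨⟨?_, h2.trans_lt enorm_lt_top⟩, h2⟩
  exact Complex.reCLM.comp_analyticOnNhd u.analyticOnNhd_ev

/-! ### Integrals over the torus -/

section Torus

variable {d : ℕ}

lemma integral_fourier (n : ℤ) :
    ∫ x : AddCircle (2 * Real.pi), (fourier n x : ℂ) = if n = 0 then ((2 * Real.pi : ℝ) : ℂ) else 0 := by
  have h := fourierCoeff_fourier (T := 2 * Real.pi) n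
  have h0 : fourierCoeff (fourier n : AddCircle (2 * Real.pi) → ℂ) 0 =
      ((2 * Real.pi : ℝ) : ℂ)⁻¹ * ∫ x : AddCircle (2 * Real.pi), (fourier n x : ℂ) := by
    rw [fourierCoeff, AddCircle.integral_haarAddCircle]
    simp
  rw [h] at h0
  have hpi : ((2 * Real.pi : ℝ) : ℂ) ≠ 0 := by exact_mod_cast Real.two_pi_pos.ne'
  rw [eq_comm, inv_mul_eq_iff_eq_mul₀ hpi] at h0
  rw [h0, Pi.single_apply]
  by_cases hn : n = 0
  · simp [hn]
  · simp [hn, Ne.symm hn]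

lemma integral_expMode (k : Fin d → ℤ) :
    ∫ x : Torus d, expMode k x = if k = 0 then (((2 * Real.pi) ^ d : ℝ) : ℂ) else 0 := by
  have h : ∫ x : Torus d, expMode k x = ∏ i, ∫ x : AddCircle (2 * Real.pi), (fourier (k i) x : ℂ) :=
    integral_fintype_prod_volume_eq_prod (fun i x => (fourier (k i) x : ℂ))
  rw [h]
  simp_rw [integral_fourier]
  by_cases hk : k = 0
  · simp [hk]
  · obtain ⟨i, hi⟩ := Function.ne_iff.mp hk
    rw [if_neg hk]
    exact Finset.prod_eq_zero (Finset.mem_univ i) (if_neg hi)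

lemma fourierConst_sq_mul (d : ℕ) : fourierConst d * fourierConst d * (2 * Real.pi) ^ d = 1 := by
  have h : (0 : ℝ) < 2 * Real.pi := Real.two_pi_pos
  rw [fourierConst, ← Real.rpow_add h, ← Real.rpow_natCast, ← Real.rpow_add h]
  have : -(d : ℝ) / 2 + -(d : ℝ) / 2 + d = 0 := by ring
  rw [this, Real.rpow_zero]

lemma expMode_sub (j k : Fin d → ℤ) (x : Torus d) :
    starRingEnd ℂ (expMode j x) * expMode k x = expMode (k - j) x := by
  rw [← expMode_neg]
  simp only [expMode, ContinuousMap.coe_mk, ← Finset.prod_mul_distrib]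
  refine Finset.prod_congr rfl fun i _ => ?_
  rw [← fourier_add]
  congr 2
  simp [sub_eq_neg_add]

lemma inner_modeLp (j k : Fin d → ℤ) : ⟪modeLp j, modeLp k⟫_ℂ = if j = k then 1 else 0 := by
  rw [modeLp, modeLp, inner_smul_left, inner_smul_right, ContinuousMap.inner_toLp]
  have h1 : ∀ x : Torus d, expMode k x * starRingEnd ℂ (expMode j x) = expMode (k - j) x :=
    fun x => by rw [mul_comm, expMode_sub]
  have h2 := fourierConst_sq_mul d
  simp only [h1, integral_expMode, sub_eq_zero, Complex.conj_ofReal]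
  by_cases h : j = k
  · rw [if_pos h.symm, if_pos h, ← mul_assoc]
    exact_mod_cast h2
  · rw [if_neg (Ne.symm h), if_neg h]; simp

/-- The Fourier basis of `L²(𝕋^d)`. -/
def modeBasis (d : ℕ) : HilbertBasis (Fin d → ℤ) ℂ (L2Torus d) :=
  HilbertBasis.mkOfOrthogonalEqBot (v := modeLp)
    (orthonormal_iff_ite.mpr fun j k => by convert inner_modeLp j k) (by
      rw [Submodule.eq_bot_iff]
      intro ψ hψ
      refine eq_zero_of_coeffL2_eq_zero ψ fun k => ?_
      exact (Submodule.mem_orthogonal _ _).mp hψ _ (Submodule.subset_span ⟨k, rfl⟩))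

lemma modeBasis_apply (k : Fin d → ℤ) : modeBasis d k = modeLp k := by
  rw [modeBasis, HilbertBasis.coe_mkOfOrthogonalEqBot]

lemma inner_modeBasis (k : Fin d → ℤ) (ψ : L2Torus d) : ⟪modeBasis d k, ψ⟫_ℂ = coeffL2 ψ k := by
  rw [modeBasis_apply, coeffL2]

/-! ### Symbols -/

lemma symbolCoeff_neg (V : Torus d → Space d → ℝ) (k : Fin d → ℤ) (ξ : Space d) :
    symbolCoeff (fun x ξ => (V x ξ : ℂ)) (-k) ξ =
      starRingEnd ℂ (symbolCoeff (fun x ξ => (V x ξ : ℂ)) k ξ) := by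
  rw [symbolCoeff, symbolCoeff, map_mul, Complex.conj_ofReal, ← integral_conj]
  simp only [map_mul, Complex.conj_ofReal, ← expMode_neg]

/-- The lift to ℝ^d is analytic and the torus carries the quotient topology. Continuity gives the
integrability in x needed to split off R. -/
lemma MemSymbolAlg.continuous {s ρ : ℝ} {V : Torus d → Space d → ℝ} (hV : MemSymbolAlg s ρ V)
    (ξ : Space d) : Continuous fun x => V x ξ := by
  have hq : Topology.IsQuotientMap
      (Pi.map fun (_ : Fin d) (t : ℝ) => (t : AddCircle (2 * Real.pi))) :=
    (IsOpenQuotientMap.piMap fun _ => QuotientAddGroup.isOpenQuotientMap_mk).isQuotientMap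
  rw [hq.continuous_iff]
  have h1 : Continuous fun p : Space d × Space d =>
      V (fun i => (p.1 i : AddCircle (2 * Real.pi))) p.2 := by
    rw [← continuousOn_univ]
    exact hV.analytic.continuousOn
  exact h1.comp ((PiLp.continuous_toLp 2 _).prodMk continuous_const : Continuous
    fun t : Fin d → ℝ => (WithLp.toLp 2 t, ξ))

/-- A symbol independent of x has only the zero Fourier mode, hence is quantized as a diagonal
matrix, and ħ(j + k)/2 = ħj when j = k. -/
lemma weylEntry_sub {s ρ : ℝ} {V : Torus d → Space d → ℝ} (hV : MemSymbolAlg s ρ V)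
    (R : Space d → ℝ) (h : ℝ) (j k : Fin d → ℤ) :
    weylEntry h (fun x ξ => ((V x ξ - R ξ : ℝ) : ℂ)) j k =
      weylEntry h (fun x ξ => (V x ξ : ℂ)) j k -
        if j = k then (R (h • latticeVec j) : ℂ) else 0 := by
  set ξ := (h / 2) • latticeVec (j + k) with hξ
  have hi : Integrable fun x : Torus d => (V x ξ : ℂ) * expMode (-(j - k)) x :=
    ((Complex.continuous_ofReal.comp (hV.continuous ξ)).mul
      (map_continuous _)).integrable_of_hasCompactSupport (HasCompactSupport.of_compactSpace _)
  have hi' : Integrable fun x : Torus d => (R ξ : ℂ) * expMode (-(j - k)) x :=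
    (continuous_const.mul (map_continuous _)).integrable_of_hasCompactSupport
      (HasCompactSupport.of_compactSpace _)
  have h1 : ∀ x : Torus d, ((V x ξ - R ξ : ℝ) : ℂ) * expMode (-(j - k)) x =
      (V x ξ : ℂ) * expMode (-(j - k)) x - (R ξ : ℂ) * expMode (-(j - k)) x := fun x => by
    push_cast; ring
  have h2 : ∫ x : Torus d, ((V x ξ - R ξ : ℝ) : ℂ) * expMode (-(j - k)) x =
      (∫ x : Torus d, (V x ξ : ℂ) * expMode (-(j - k)) x) -
      (R ξ : ℂ) * ∫ x : Torus d, expMode (-(j - k)) x := by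
    simp_rw [h1]
    rw [integral_sub hi hi', integral_const_mul]
  rw [weylEntry, weylEntry, ← hξ, symbolCoeff, symbolCoeff, h2, integral_expMode]
  have h3 := fourierConst_sq_mul d
  by_cases hjk : j = k
  · subst hjk
    have h4 : ξ = h • latticeVec j := by
      rw [hξ, latticeVec_add, ← two_smul ℝ, smul_smul]
      congr 1; ring
    have h5 : (fourierConst d : ℂ) * fourierConst d * ((2 * Real.pi) ^ d : ℝ) = 1 := by
      exact_mod_cast h3
    simp only [sub_self, neg_zero, if_true, ← h4]
    linear_combination -(R ξ : ℂ) * h5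
  · have : -(j - k) ≠ 0 := neg_ne_zero.mpr (sub_ne_zero.mpr hjk)
    simp only [if_neg this, if_neg hjk, mul_zero, sub_zero]

end Torus

end

/-! ### Conjugation of the quantized symbol -/

noncomputable section

open ContinuousLinearMap

variable {d : ℕ}

lemma frequency_ne_zero {ω : Space d} {ς γ : ℝ} (hς : 0 < ς) (hω : IsDiophantine ω ς γ)
    (k : Fin d → ℤ) (hk : k ≠ 0) : frequency ω k ≠ 0 := by
  have h1 := hω k hk
  rw [real_inner_comm] at h1
  have h2 : 0 < ς / ‖latticeVec k‖ ^ (γ - 1) :=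
    div_pos hς (Real.rpow_pos_of_pos (norm_pos_iff.mpr (latticeVec_ne_zero hk)) _)
  exact abs_pos.mp (h2.trans_le h1)

lemma spaceNorm_symbolCoeff_lt_top {s ρ : ℝ} {a : Torus d → Space d → ℂ}
    (ha : symbolNorm s ρ a < ∞) (k : Fin d → ℤ) : spaceNorm s (symbolCoeff a k) < ∞ := by
  have hc := ENNReal.ofReal_pos.mpr (fourierConst_pos d)
  have h1 := ENNReal.lt_top_of_mul_ne_top_right ha.ne hc.ne'
  have h2 := (ENNReal.le_tsum k).trans_lt h1
  exact ENNReal.lt_top_of_mul_ne_top_left h2.ne (ENNReal.ofReal_pos.mpr (Real.exp_pos _)).ne'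

/-- The matrix form of the conjugation theorem. -/
theorem exists_intertwining {s : ℝ} [Fact (0 < s)] {ω : Space d} {ς γ ρ : ℝ} (hς : 0 < ς)
    (hγ : 1 < γ) (hω : IsDiophantine ω ς γ) (hρ : 0 < ρ) {V : Torus d → Space d → ℝ}
    (hV : MemSymbolAlg s ρ V)
    (hsmall : symbolNorm s ρ (fun x ξ => (V x ξ : ℂ)) ≤
      ENNReal.ofReal (ς / 64 * (Real.sqrt ρ / (2 * (γ - 1))) ^ (2 * (γ - 1)))) (h : ℝ) :
    ∃ (r : FourierAlg d s) (A U : L2Torus d →L[ℂ] L2Torus d),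
      ‖r‖ₑ ≤ 2 * symbolNorm s ρ (fun x ξ => (V x ξ : ℂ)) ∧
      (∀ j k, entry (modeBasis d) A j k =
        weylEntry h (fun x ξ => ((V x ξ - (r.ev ξ).re : ℝ) : ℂ)) j k) ∧
      adjoint U * U = 1 ∧ U * adjoint U = 1 ∧
      HasCommutator (modeBasis d) (frequency ω) U (U * A) := by
  classical
  set a : Torus d → Space d → ℂ := fun x ξ => (V x ξ : ℂ) with ha
  have hfin := hV.norm_lt_top
  choose u hu using fun k => FourierAlg.exists_ev_eq (s := s) (spaceNorm_symbolCoeff_lt_top hfin k)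
  set ε := (symbolNorm s ρ a).toReal with hε
  have hεe : ENNReal.ofReal ε = symbolNorm s ρ a := ENNReal.ofReal_toReal hfin.ne
  have hεV : ε ≤ ς / 64 * (Real.sqrt ρ / (2 * (γ - 1))) ^ (2 * (γ - 1)) := by
    refine ENNReal.toReal_le_of_le_ofReal ?_ hsmall
    have : 0 < γ - 1 := by linarith
    positivity
  have hc := fourierConst_pos d
  -- The half-shift converts the Weyl midpoint into the left endpoint used by the representation: ħj
  -- - ħ(j - k)/2 = ħ(j + k)/2.
  let v : (Fin d → ℤ) → FourierAlg d s := fun k =>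
    FourierAlg.translate ((h / 2) • latticeVec k) ((fourierConst d : ℂ) • u k)
  have hvn : ∀ k, ‖v k‖ₑ = ENNReal.ofReal (fourierConst d) * spaceNorm s (symbolCoeff a k) :=
    fun k => by
      rw [← hu k, FourierAlg.spaceNorm_ev, ← ofReal_norm, ← ofReal_norm,
        ← ENNReal.ofReal_mul hc.le, FourierAlg.norm_translate, norm_smul, Complex.norm_real,
        Real.norm_of_nonneg hc.le]
  have hv : ∑' k, ‖v k‖ₑ * ENNReal.ofReal (Real.exp (‖latticeVec k‖ * ρ)) ≤ ENNReal.ofReal ε := by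
    rw [hεe, symbolNorm, ← ENNReal.tsum_mul_left]
    simp only [hvn, mul_assoc, le_refl]
  obtain ⟨a', W, Z, r, hva, -, hZW, hW1, hr, hD⟩ :=
    exists_counterterm_fourierAlg h hς hγ hω hρ ENNReal.toReal_nonneg hεV hv
  let χ : (Fin d → ℤ) → UnitalAlg d s →ₐ[ℂ] ℂ := fun j => UnitalAlg.char (h • latticeVec j)
  have hχ : ∀ j c, ‖χ j c‖ ≤ ‖c‖ := fun j c => UnitalAlg.norm_char_le _ c
  have hT : ∀ j m c, χ j ((UnitalAlg.latticeAction d s h).toFun m c) = χ (j - m) c := fun j m c => by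
    change UnitalAlg.char _ _ = UnitalAlg.char _ _
    rw [UnitalAlg.char_action, latticeVec_sub, smul_sub]
  set b := modeBasis d
  let A₀ := crossedOp b hχ a'
  let D := crossedOp b hχ (Crossed.diag (UnitalAlg.latticeAction d s h) (UnitalAlg.incl r))
  have hA₀ : ∀ j k, entry b A₀ j k = weylEntry h a j k := fun j k => by
    rw [entry_crossedOp, hva]
    change UnitalAlg.char _ _ = _
    rw [UnitalAlg.char_incl, FourierAlg.ev_translate, FourierAlg.ev_smul, hu, weylEntry]
    congr 2
    rw [latticeVec_sub, latticeVec_add]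
    module
  have hDe : ∀ j k, entry b D j k = if j = k then r.ev (h • latticeVec j) else 0 := fun j k => by
    rw [entry_crossedOp, Crossed.diag_apply]
    by_cases hjk : j = k
    · rw [if_pos (sub_eq_zero.mpr hjk), if_pos hjk]
      exact UnitalAlg.char_incl _ _
    · rw [if_neg (sub_ne_zero.mpr hjk), if_neg hjk, map_zero]
  have hA₀s : adjoint A₀ = A₀ := ext_entry (b := b) fun j k => by
    rw [entry_adjoint, hA₀, hA₀, weylEntry, weylEntry, map_mul, Complex.conj_ofReal,
      ← symbolCoeff_neg, neg_sub, add_comm k j]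
  have hcomm : HasCommutator b (frequency ω) (crossedOp b hχ W) (crossedOp b hχ W * (A₀ - D)) := by
    intro j k
    rw [← crossedOp_sub, ← crossedOp_mul b hχ hT, entry_crossedOp, entry_crossedOp, hD, map_smul,
      map_sub, smul_eq_mul]
    push_cast
    rfl
  have hW1' : ‖crossedOp b hχ W - 1‖ ≤ 1 / 10 := by
    rw [← crossedOp_one b hχ, ← crossedOp_sub]
    exact (norm_crossedOp_le b hχ _).trans hW1
  have hZW' : crossedOp b hχ Z * crossedOp b hχ W = 1 := by
    rw [← crossedOp_mul b hχ hT, hZW, crossedOp_one]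
  have hDs : adjoint D = D :=
    counterterm_selfAdjoint hA₀s (fun j k hjk => by rw [hDe, if_neg hjk]) hW1' hcomm
  have hAs : adjoint (A₀ - D) = A₀ - D := by rw [map_sub, hA₀s, hDs]
  obtain ⟨U, hU1, hU2, hU⟩ :=
    exists_unitary (frequency_ne_zero hς hω) hAs hZW' hW1' hcomm
  refine ⟨r, A₀ - D, U, ?_, fun j k => ?_, hU1, hU2, hU⟩
  · rw [← hεe, ← ofReal_norm, ← ENNReal.ofReal_ofNat 2, ← ENNReal.ofReal_mul (by norm_num)]
    exact ENNReal.ofReal_le_ofReal hr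
  · rw [entry_sub, hA₀, hDe, weylEntry_sub hV (fun ξ => (r.ev ξ).re) h j k]
    congr 1
    -- Self-adjointness of D says that r is real at the points ħj, so passing to the real part does
    -- not change the matrix.
    by_cases hjk : j = k
    · subst hjk
      rw [if_pos rfl, if_pos rfl, eq_comm, ← Complex.conj_eq_iff_re]
      have h1 := hDe j j
      rw [if_pos rfl] at h1
      rw [← h1, ← entry_adjoint, hDs]
    · rw [if_neg hjk, if_neg hjk]

/-! ### Operators -/

lemma mem_freeGraph {ω : Space d} {h : ℝ} {ψ φ : L2Torus d} : (ψ, φ) ∈ (freeOp ω h).graph ↔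
    ∀ k, ⟪modeBasis d k, φ⟫_ℂ = ((h * frequency ω k : ℝ) : ℂ) * ⟪modeBasis d k, ψ⟫_ℂ := by
  rw [freeOp_graph]
  simp only [inner_modeBasis]
  rfl

lemma mem_weylOp_graph {h : ℝ} {a : Torus d → Space d → ℂ} {A : L2Torus d →L[ℂ] L2Torus d}
    (hA : ∀ j k, entry (modeBasis d) A j k = weylEntry h a j k) (ψ : L2Torus d) :
    (ψ, A ψ) ∈ (weylOp h a).graph := by
  rw [weylOp_graph]
  intro j
  simp only [← inner_modeBasis, ← hA]
  exact hasSum_entry_apply _ A ψ j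

lemma weylOp_domain {h : ℝ} {a : Torus d → Space d → ℂ} {A : L2Torus d →L[ℂ] L2Torus d}
    (hA : ∀ j k, entry (modeBasis d) A j k = weylEntry h a j k) : (weylOp h a).domain = ⊤ :=
  eq_top_iff.mpr fun ψ _ => LinearPMap.mem_domain_of_mem_graph (mem_weylOp_graph hA ψ)

lemma weylOp_apply {h : ℝ} {a : Torus d → Space d → ℂ} {A : L2Torus d →L[ℂ] L2Torus d}
    (hA : ∀ j k, entry (modeBasis d) A j k = weylEntry h a j k) (ψ : (weylOp h a).domain) :
    weylOp h a ψ = A ψ :=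
  LinearPMap.mem_graph_snd_inj' _ (LinearPMap.mem_graph _ ψ) (mem_weylOp_graph hA ψ) rfl

/-- The domain of `U T U^*` and its values. -/
lemma unitaryConj_eq {U : L2Torus d ≃ₗᵢ[ℂ] L2Torus d} {S T : L2Torus d →ₗ.[ℂ] L2Torus d}
    (h1 : ∀ x ∈ T.domain, U x ∈ S.domain) (h2 : ∀ x ∈ S.domain, U.symm x ∈ T.domain)
    (h3 : ∀ (x : T.domain) (y : S.domain), (y : L2Torus d) = U x → S y = U (T x)) :
    unitaryConj U T = S := by
  refine LinearPMap.ext ?_ ?_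
  · ext x
    refine ⟨fun hx => ?_, fun hx => h2 x hx⟩
    have := h1 _ hx
    change U (U.symm x) ∈ _ at this
    rwa [U.apply_symm_apply] at this
  · intro x hx hy
    exact (h3 ⟨U.symm x, hx⟩ ⟨x, hy⟩ (U.apply_symm_apply x).symm).symm

/-- The perturbation is bounded and everywhere defined, so the domain is that of the free operator.
The commutator relation for U gives one inclusion of domains and the conjugation formula; the one
for U* gives the other inclusion. -/
theorem unitaryConj_freeOp_add {ω : Space d} {h : ℝ} (hh : h ≠ 0) {a : Torus d → Space d → ℂ}
    {A : L2Torus d →L[ℂ] L2Torus d}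
    (hA : ∀ j k, entry (modeBasis d) A j k = weylEntry h a j k)
    {U : L2Torus d →L[ℂ] L2Torus d} {U' : L2Torus d ≃ₗᵢ[ℂ] L2Torus d} (hU' : ∀ x, U' x = U x)
    (hUs : ∀ x, U'.symm x = adjoint U x)
    (hU : HasCommutator (modeBasis d) (frequency ω) U (U * A)) :
    unitaryConj U' (freeOp ω h + (h : ℂ) • weylOp h a) = freeOp ω h := by
  have hhc : (h : ℂ) ≠ 0 := by exact_mod_cast hh
  have key : ∀ {X Y : L2Torus d →L[ℂ] L2Torus d}, HasCommutator (modeBasis d) (frequency ω) X Y →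
      ∀ {x y}, (x, y) ∈ (freeOp ω h).graph → (X x, X y + (h : ℂ) • Y x) ∈ (freeOp ω h).graph := by
    intro X Y hXY x y hxy
    rw [mem_freeGraph] at hxy ⊢
    intro k
    -- The commutator is normalized by the frequencies ω·k, whereas the free operator has
    -- eigenvalues ħ ω·k; hence the rescaling of y by ħ⁻¹.
    have h1 := hXY.inner_apply (x := x) (y := (h : ℂ)⁻¹ • y) (fun k => by
      rw [inner_smul_right, hxy]; push_cast; field_simp) k
    have h2 : X y + (h : ℂ) • Y x = (h : ℂ) • (X ((h : ℂ)⁻¹ • y) + Y x) := by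
      rw [map_smul, smul_add, smul_smul, mul_inv_cancel₀ hhc, one_smul]
    rw [h2, inner_smul_right, h1]
    push_cast
    ring
  have hdom : (freeOp ω h + (h : ℂ) • weylOp h a).domain = (freeOp ω h).domain := by
    rw [LinearPMap.add_domain, LinearPMap.smul_domain, weylOp_domain hA, inf_top_eq]
  refine unitaryConj_eq (fun x hx => ?_) (fun x hx => ?_) (fun x y hxy => ?_)
  · rw [hdom] at hx
    rw [hU']
    exact LinearPMap.mem_domain_of_mem_graph (key hU (LinearPMap.mem_graph _ ⟨x, hx⟩))
  · rw [hdom, hUs]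
    exact LinearPMap.mem_domain_of_mem_graph (key hU.adjoint (LinearPMap.mem_graph _ ⟨x, hx⟩))
  · have hx : (x : L2Torus d) ∈ (freeOp ω h).domain := hdom ▸ x.2
    have h1 := key hU (LinearPMap.mem_graph (freeOp ω h) ⟨x, hx⟩)
    have h2 := LinearPMap.mem_graph_snd_inj' _ (LinearPMap.mem_graph _ y) h1
      (by rw [hxy, hU'])
    refine h2.trans ?_
    rw [hU', LinearPMap.add_apply, LinearPMap.smul_apply, weylOp_apply hA, map_add, map_smul]
    rfl

theorem exists_normalForm {s : ℝ} (hs : 0 < s) {ω : Space d} {ς γ ρ : ℝ} (hς : 0 < ς)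
    (hγ : 1 < γ) (hω : IsDiophantine ω ς γ) (hρ : 0 < ρ) {V : Torus d → Space d → ℝ}
    (hV : MemSymbolAlg s ρ V)
    (hsmall : symbolNorm s ρ (fun x ξ => (V x ξ : ℂ)) ≤
      ENNReal.ofReal (ς / 64 * (Real.sqrt ρ / (2 * (γ - 1))) ^ (2 * (γ - 1)))) {h : ℝ}
    (hh : h ≠ 0) :
    ∃ (U : L2Torus d ≃ₗᵢ[ℂ] L2Torus d) (R : Space d → ℝ), MemSpaceAlg s R ∧
      spaceNorm s (fun ξ => (R ξ : ℂ)) ≤ 2 * symbolNorm s ρ (fun x ξ => (V x ξ : ℂ)) ∧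
      (weylOp h (fun x ξ => ((V x ξ - R ξ : ℝ) : ℂ))).domain = ⊤ ∧
      unitaryConj U (freeOp ω h + (h : ℂ) • weylOp h (fun x ξ => ((V x ξ - R ξ : ℝ) : ℂ))) =
        freeOp ω h := by
  have : Fact (0 < s) := ⟨hs⟩
  obtain ⟨r, A, U, hr, hA, hU1, hU2, hU⟩ := exists_intertwining hς hγ hω hρ hV hsmall h
  let U' := Unitary.linearIsometryEquiv (⟨U, Unitary.mem_iff.mpr ⟨hU1, hU2⟩⟩ :
    unitary (L2Torus d →L[ℂ] L2Torus d))
  obtain ⟨hR, hRn⟩ := r.memSpaceAlg_re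
  exact ⟨U', fun ξ => (r.ev ξ).re, hR, hRn.trans hr, weylOp_domain hA,
    unitaryConj_freeOp_add hh hA (U' := U') (fun _ => rfl) (fun _ => rfl) hU⟩

end

end QuantumKAM

theorem mainTheorem4 (d : ℕ) (hd : 1 ≤ d)
    (ω : QuantumKAM.Space d) (ς γ : ℝ) (hς : 0 < ς) (hγ : (d : ℝ) < γ)
    (hω : QuantumKAM.IsDiophantine ω ς γ)
    (s ρ : ℝ) (hs : 0 < s) (hρ : 0 < ρ)
    (V : QuantumKAM.Torus d → QuantumKAM.Space d → ℝ)
    (hV : QuantumKAM.MemSymbolAlg s ρ V)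
    (hsmall : QuantumKAM.symbolNorm s ρ (fun x ξ => (V x ξ : ℂ)) ≤
      ENNReal.ofReal (ς / 64 * (Real.sqrt ρ / (2 * (γ - 1))) ^ (2 * (γ - 1)))) :
    ∃ (U : ℝ → (QuantumKAM.L2Torus d ≃ₗᵢ[ℂ] QuantumKAM.L2Torus d))
      (R : ℝ → QuantumKAM.Space d → ℝ),
      ∀ h ∈ Set.Ioc (0 : ℝ) 1,
        QuantumKAM.MemSpaceAlg s (R h) ∧
        QuantumKAM.spaceNorm s (fun ξ => (R h ξ : ℂ)) ≤
          2 * QuantumKAM.symbolNorm s ρ (fun x ξ => (V x ξ : ℂ)) ∧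
        (QuantumKAM.weylOp h (fun x ξ => ((V x ξ - R h ξ : ℝ) : ℂ))).domain = ⊤ ∧
        QuantumKAM.unitaryConj (U h)
          (QuantumKAM.freeOp ω h +
            (h : ℂ) • QuantumKAM.weylOp h (fun x ξ => ((V x ξ - R h ξ : ℝ) : ℂ))) =
          QuantumKAM.freeOp ω h := by
  have hγ1 : 1 < γ := lt_of_le_of_lt (by exact_mod_cast hd) hγ
  have key := fun (h : ℝ) (hh : h ∈ Set.Ioc (0 : ℝ) 1) =>
    QuantumKAM.exists_normalForm hs hς hγ1 hω hρ hV hsmall hh.1.ne'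
  choose U R hUR using key
  classical
  -- Outside (0, 1] the values are irrelevant; the identity and zero are fillers.
  refine ⟨fun h => if hh : h ∈ Set.Ioc (0 : ℝ) 1 then U h hh else .refl ℂ _,
    fun h => if hh : h ∈ Set.Ioc (0 : ℝ) 1 then R h hh else 0, fun h hh => ?_⟩
  simp only [dif_pos hh]
  exact hUR h hh
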